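/- Let $\mathbb{F}$ be a field of characteristic $p$ (zero or prime), and let $f=g/h\in\mathbb{F}(X)$ with $g,h\in\mathbb{F}[X]$ coprime have degree $d=\max\{\deg g,\deg h\}\ge 2$. Write $f^{(0)}=X$ and $f^{(k)}=f\circ f^{(k-1)}$ for $k\ge 1$. Suppose that $f$ is not a monomial $aX^m$ ($a\in\mathbb{F}$, $m\in\mathbb{Z}$), is not of the form $aX^{p^\ell}+b$ ($a,b\in\mathbb{F}$, $\ell\ge 0$), and is not linearly conjugate over $\mathbb{F}$ to $1/X^d$, that is, $1/X^d\ne\psi^{-1}\circ f\circ\psi$ for every $\psi\in\mathbb{F}(X)$ of degree $1$. For $n\ge 1$ put \[ \Psi(n)=\min_{\substack{k_1,\ldots,k_n\in\mathbb{Z}\\ k_n\neq 0}}\deg\left(\left(f^{(1)}\right)^{k_1}\cdots\left(f^{(n)}\right)^{k_n}\right), \] and let $e$ be the smallest positive integer $k$ such that $0$ is a zero of $f^{(k)}$ ($e=\infty$ if there is none). Then: (i) If $f\in\mathbb{F}[X]$, then for every $n\ge 1$, $\Psi(n)\ge d^n$ if $n\le e$, and $\Psi(n)\ge d^{n-e}$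 otherwise. (ii) If $\deg g>\deg h\ge 1$ or $1\le\deg g<\deg h$, then $\Psi(n)\ge d^{n-1}$ for every $n\ge 1$. (iii) Suppose that $\deg g=0<\deg h$ or $\deg g=\deg h$, and suppose moreover that $f$ is separable (that is, the field extension $\mathbb{F}(X)/\mathbb{F}(f)$ is separable) or that $f$ is not of the form $L(X^{p^\ell})$ with $L\in\mathbb{F}(X)$ of degree $1$ and $\ell\ge 0$. Then there is an integer $j\ge 0$, depending only on $f$, such that for every $n\ge 1$, $\Psi(n)\ge d^n$ if $n\le j$, and $\Psi(n)\ge d^{n-j}$ otherwise. -/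

import Mathlib

namespace RationalIteration

variable {F : Type*} [Field F]

/-- The degree `max (deg g) (deg h)` of a rational function `g / h` in lowest terms. -/
noncomputable def degree (f : RatFunc F) : ℕ :=
  max f.num.natDegree f.denom.natDegree

/-- The composition `u ∘ v` of rational functions, i.e. `u` evaluated at `v` in `F(X)`.
It is only used for non-constant `v`, where no denominator vanishes. -/
noncomputable def comp (u v : RatFunc F) : RatFunc F :=
  RatFunc.eval RatFunc.C v u

/-- The iterates of `f`, starting from the identity function `X`. -/
noncomputable def iter (f : RatFunc F) : ℕ → RatFunc F
  | 0 => RatFunc.X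
  | k + 1 => comp f (iter f k)

/-- `φ'` is equal to `ψ⁻¹ ∘ φ ∘ ψ` for some `ψ ∈ F(X)` of degree one, where `χ` is the
compositional inverse of `ψ`. -/
def LinearlyConjugate (φ φ' : RatFunc F) : Prop :=
  ∃ ψ χ : RatFunc F, degree ψ = 1 ∧ comp ψ χ = RatFunc.X ∧ comp χ ψ = RatFunc.X ∧
    φ' = comp χ (comp φ ψ)

/-- `f` is separable: `F(X)` is a separable extension of its subfield `F(f)`. -/
def Separable (f : RatFunc F) : Prop :=
  Algebra.IsSeparable (IntermediateField.adjoin F {f}) (RatFunc F)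

/-- The least positive `k` such that `0` is a zero of the `k`-th iterate of `f`,
and `⊤` if there is none. -/
noncomputable def zeroPeriod (f : RatFunc F) : ℕ∞ :=
  ⨅ k ∈ {k : ℕ | 1 ≤ k ∧ (iter f k).num.eval 0 = 0}, (k : ℕ∞)

/-- The least degree of a product of integer powers of the first `n` iterates of `f`, where
the exponent of the `n`-th iterate is nonzero (for `n ≥ 1`). -/
noncomputable def Psi (f : RatFunc F) (n : ℕ) : ℕ :=
  sInf {m : ℕ | ∃ k : ℕ → ℤ, k n ≠ 0 ∧ m = degree (∏ i ∈ Finset.Icc 1 n, iter f i ^ k i)}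

end RationalIteration

/-!
Let `f = g / h` have degree `d`. The argument takes place on the projective line over an algebraic
closure `K` of `F`, where a rational function of degree `N` has `N` zeros and `N` poles with
multiplicity.

*Counting.* Suppose that `f⁽ⁿ⁻ᵐ⁾(β)` is `0` or `∞`, and that no point `α` of the fibre
`f⁽ᵐ⁾(α) = β` satisfies `f⁽ⁱ⁾(α) ∈ {0, ∞}` for some `0 < i < n` (`HasFreshFibre`). The fibre has
`d ^ m` points with multiplicity. All of them are zeros of `f⁽ⁿ⁾`, or all of them are poles, and no
`f⁽ⁱ⁾` with `i < n` can cancel them in a product `∏ (f⁽ⁱ⁾) ^ kᵢ` with `kₙ ≠ 0`; so this product has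
degree at least `d ^ m` (`IsLowest.pow_le_max_natDegree`, `pow_le_Psi`). In the proof points are
handled through binary forms (`homEval`), so that `∞` needs no separate treatment: the iterates are
`Gₙ / Hₙ` with `Gₙ`, `Hₙ` forms of degree `d ^ n` (`iterPair`), and the fibre is the zero set of
`y_β Gₘ - x_β Hₘ`, a divisor of `Gₙ` or of `Hₙ`.

*Dynamics.* Fresh fibres exist unless `0` and `∞` return to themselves or to each other too
rigidly. If one of the points, say `t`, is never reached from `{0, ∞}`, every fibre `f⁽ⁿ⁾(α) = t` is
fresh. If all orbit segments from `{0, ∞}` to `t` are at the same point `s` exactly `b` steps before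
their end (`EntersThrough`), then `m = n - b` works for `n ≥ b` as soon as some `β ≠ s` satisfies
`f⁽ᵇ⁾(β) = t`, and `m = n` works for `n ≤ b`. In the first two cases of the theorem `b` is the
period of `0` and `1`, respectively; in the third case `0` and `∞` lie on one cycle or on two
(`exists_hasFreshFibre_or_uniquePreimage`), and either of the two points may play the role of `t`.

*Ramification.* If `s` is the only preimage of `t` under `f⁽ᵇ⁾`, then each of the points
`s, f(s), …, f⁽ᵇ⁻¹⁾(s)` is the only preimage of its image under `f`. When `0` and `∞` have this
property, `g` and `h` are linear combinations of `1` and `X ^ d`; when a third point `c` has it,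
`(X - c) ^ d - X ^ d` is constant, so that `d` is a power of `p`
(`IsLowest.exists_eq_pow_of_uniquePreimage`). This makes `f` one of the excluded functions: a
monomial, `a X ^ (p ^ l) + b`, or a fractional linear function of `X ^ (p ^ l)`, which is
inseparable since `X` is then purely inseparable over `F(f)` (`not_separable_of_X_pow`).
-/

namespace RationalIteration

open Polynomial

/-! ### Binary forms -/

section Forms

variable {R A B : Type*} [CommRing R] [CommRing A] [Algebra R A] [CommRing B] [Algebra R B]

/-- The value at `(x, y)` of the binary form of degree `n` with dehomogenization `P`, for `P` of
degree at most `n` (coefficients beyond `n` are dropped). -/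
noncomputable def homEval (n : ℕ) (P : R[X]) (x y : A) : A :=
  MvPolynomial.aeval ![x, y] (P.homogenize n)

lemma homEval_eq_sum (n : ℕ) (P : R[X]) (x y : A) :
    homEval n P x y =
      ∑ kl ∈ Finset.HasAntidiagonal.antidiagonal n,
        algebraMap R A (P.coeff kl.1) * (x ^ kl.1 * y ^ kl.2) := by
  simp only [homEval, homogenize, map_sum, MvPolynomial.aeval_monomial]
  refine Finset.sum_congr rfl fun kl _ ↦ ?_
  rw [Finsupp.prod_fintype _ _ (by simp)]
  simp

lemma homEval_right_one {n : ℕ} {P : R[X]} (hP : P.natDegree ≤ n) (x : A) :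
    homEval n P x 1 = aeval x P := by
  rw [homEval, aeval_homogenize_of_eq_one hP] <;> simp

lemma homEval_one_zero (n : ℕ) (P : R[X]) :
    homEval n P (1 : A) 0 = algebraMap R A (P.coeff n) := by
  rw [homEval_eq_sum, Finset.sum_eq_single (n, 0)]
  · simp
  · rintro ⟨k, l⟩ hkl hne
    have hl : l ≠ 0 := by
      rintro rfl
      exact hne (by simpa using hkl)
    simp [hl]
  · simp

lemma homEval_zero_one (n : ℕ) (P : R[X]) :
    homEval n P (0 : A) 1 = algebraMap R A (P.coeff 0) := by
  rw [homEval_eq_sum, Finset.sum_eq_single (0, n)]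
  · simp
  · rintro ⟨k, l⟩ hkl hne
    have hk : k ≠ 0 := by
      rintro rfl
      exact hne (by simpa using hkl)
    simp [hk]
  · simp

lemma homEval_mul {m n : ℕ} {P Q : R[X]} (hP : P.natDegree ≤ m) (hQ : Q.natDegree ≤ n) (x y : A) :
    homEval (m + n) (P * Q) x y = homEval m P x y * homEval n Q x y := by
  rw [homEval, homogenize_mul _ _ hP hQ, map_mul]; rfl

lemma homEval_sub (n : ℕ) (P Q : R[X]) (x y : A) :
    homEval n (P - Q) x y = homEval n P x y - homEval n Q x y := by
  simp [homEval, homogenize_sub]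

lemma homEval_C_mul (n : ℕ) (c : R) (P : R[X]) (x y : A) :
    homEval n (C c * P) x y = algebraMap R A c * homEval n P x y := by
  simp [homEval, homogenize_C_mul]

lemma homEval_mul_left (n : ℕ) (P : R[X]) (c x y : A) :
    homEval n P (c * x) (c * y) = c ^ n * homEval n P x y := by
  simp only [homEval_eq_sum, Finset.mul_sum]
  refine Finset.sum_congr rfl fun kl hkl ↦ ?_
  rw [Finset.HasAntidiagonal.mem_antidiagonal] at hkl
  rw [← hkl, mul_pow, mul_pow, pow_add]
  ring

lemma map_homEval (φ : A →ₐ[R] B) (n : ℕ) (P : R[X]) (x y : A) :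
    φ (homEval n P x y) = homEval n P (φ x) (φ y) := by
  simp [homEval_eq_sum]

lemma homEval_map {S : Type*} [CommRing S] [Algebra R S] [Algebra S A] [IsScalarTower R S A]
    (n : ℕ) (P : R[X]) (x y : A) :
    homEval n (P.map (algebraMap R S)) x y = homEval n P x y := by
  simp only [homEval_eq_sum, coeff_map, ← IsScalarTower.algebraMap_apply]

lemma natDegree_homEval_le {d e : ℕ} {g P Q : R[X]} (hP : P.natDegree ≤ e)
    (hQ : Q.natDegree ≤ e) : (homEval d g P Q).natDegree ≤ e * d := by
  rw [homEval_eq_sum]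
  refine natDegree_sum_le_of_forall_le _ _ fun kl hkl ↦ ?_
  rw [Finset.HasAntidiagonal.mem_antidiagonal] at hkl
  rw [algebraMap_eq]
  refine natDegree_C_mul_le _ _ |>.trans <| natDegree_mul_le.trans ?_
  rw [← hkl, mul_add, mul_comm e, mul_comm e]
  exact add_le_add (natDegree_pow_le_of_le _ hP) (natDegree_pow_le_of_le _ hQ)

/-- Substituting two forms of degree `e` into a form of degree `d` gives a form of degree
`e * d`. -/
lemma homEval_homEval {d e : ℕ} (g : R[X]) {P Q : R[X]} (hP : P.natDegree ≤ e)
    (hQ : Q.natDegree ≤ e) (x y : A) :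
    homEval (e * d) (homEval d g P Q) x y = homEval d g (homEval e P x y) (homEval e Q x y) := by
  have h : (homEval d g P Q).homogenize (e * d) =
      MvPolynomial.aeval ![P.homogenize e, Q.homogenize e] (g.homogenize d) := by
    refine homogenize_eq_of_isHomogeneous ?_ ?_
    · refine (isHomogeneous_homogenize g).aeval _ fun i ↦ ?_
      fin_cases i <;> simp
    · have := map_homEval (MvPolynomial.aeval (R := R) ![(X : R[X]), 1]) d g
        (P.homogenize e) (Q.homogenize e)
      rw [aeval_homogenize_X_one P hP, aeval_homogenize_X_one Q hQ] at this
      exact this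
  rw [homEval, h]
  exact map_homEval (MvPolynomial.aeval (R := R) ![x, y]) d g _ _

/-- The homogeneous lift `(x, y) ↦ (g(x, y), h(x, y))` of the rational function `g / h`, both `g`
and `h` being homogenized in degree `d`. -/
noncomputable def lift (d : ℕ) (g h : R[X]) (v : A × A) : A × A :=
  (homEval d g v.1 v.2, homEval d h v.1 v.2)

/-- The pair of polynomials `(Gₙ, Hₙ)` with `Gₙ / Hₙ` the `n`-th iterate of `g / h`. -/
noncomputable def iterPair (d : ℕ) (g h : R[X]) (n : ℕ) : R[X] × R[X] :=
  (lift d g h)^[n] (X, 1)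

lemma iterPair_succ (d : ℕ) (g h : R[X]) (n : ℕ) :
    iterPair d g h (n + 1) = lift d g h (iterPair d g h n) :=
  Function.iterate_succ_apply' ..

lemma natDegree_iterPair_le {d : ℕ} (g h : R[X]) (n : ℕ) :
    (iterPair d g h n).1.natDegree ≤ d ^ n ∧ (iterPair d g h n).2.natDegree ≤ d ^ n := by
  induction n with
  | zero => exact ⟨by simpa [iterPair] using natDegree_X_le, by simp [iterPair]⟩
  | succ n ih =>
    rw [iterPair_succ, pow_succ]
    exact ⟨natDegree_homEval_le ih.1 ih.2, natDegree_homEval_le ih.1 ih.2⟩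

lemma lift_iterate {d : ℕ} (g h : R[X]) (n : ℕ) (x y : A) :
    (lift d g h)^[n] (x, y) =
      (homEval (d ^ n) (iterPair d g h n).1 x y, homEval (d ^ n) (iterPair d g h n).2 x y) := by
  induction n with
  | zero =>
    have h1 := homEval_eq_sum 1 (X : R[X]) x y
    have h2 := homEval_eq_sum 1 (1 : R[X]) x y
    simp [Finset.Nat.antidiagonal_succ, coeff_one, coeff_X] at h1 h2
    simp [iterPair, h1, h2]
  | succ n ih =>
    have hd := natDegree_iterPair_le (d := d) g h n
    rw [Function.iterate_succ_apply', ih, iterPair_succ, pow_succ]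
    simp only [lift, homEval_homEval _ hd.1 hd.2]

lemma iterPair_add {d : ℕ} (g h : R[X]) (r m : ℕ) :
    iterPair d g h (r + m) =
      (homEval (d ^ r) (iterPair d g h r).1 (iterPair d g h m).1 (iterPair d g h m).2,
        homEval (d ^ r) (iterPair d g h r).2 (iterPair d g h m).1 (iterPair d g h m).2) := by
  rw [← lift_iterate, iterPair, Function.iterate_add_apply]
  rfl

lemma map_iterPair {S : Type*} [CommRing S] [Algebra R S] (d : ℕ) (g h : R[X]) (n : ℕ) :
    iterPair d (g.map (algebraMap R S)) (h.map (algebraMap R S)) n =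
      ((iterPair d g h n).1.map (algebraMap R S), (iterPair d g h n).2.map (algebraMap R S)) := by
  induction n with
  | zero => simp [iterPair]
  | succ n ih =>
    rw [iterPair_succ, ih, iterPair_succ]
    have := fun P x y ↦ map_homEval (mapAlgHom (Algebra.ofId R S)) d P x y
    simp only [coe_mapAlgHom] at this
    simp only [lift, homEval_map]
    exact Prod.ext (this _ _ _).symm (this _ _ _).symm

end Forms

/-! ### Action on the projective line -/

section ProjectiveLine

variable {K : Type*} [Field K]

open OnePoint

/-- The point `[x : y]` of the projective line `K ∪ {∞}` (with value `∞` at the meaningless pair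
`(0, 0)`). -/
noncomputable def proj (v : K × K) : OnePoint K :=
  open Classical in if v.2 = 0 then ∞ else ((v.1 / v.2 : K) : OnePoint K)

/-- Homogeneous coordinates `(a, 1)`, or `(1, 0)`, of a point of the projective line. -/
def rep (α : OnePoint K) : K × K :=
  OnePoint.rec (1, 0) (fun a ↦ (a, 1)) α

@[simp] lemma rep_infty : rep (∞ : OnePoint K) = (1, 0) := rfl

@[simp] lemma rep_coe (a : K) : rep (a : OnePoint K) = (a, 1) := rfl

lemma rep_ne_zero (α : OnePoint K) : rep α ≠ 0 := by
  induction α using OnePoint.rec <;> simp [Prod.ext_iff]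

@[simp] lemma proj_rep (α : OnePoint K) : proj (rep α) = α := by
  induction α using OnePoint.rec <;> simp [proj]

lemma proj_eq_infty_iff {v : K × K} : proj v = ∞ ↔ v.2 = 0 := by
  by_cases h : v.2 = 0 <;> simp [proj, h]

lemma proj_eq_iff {v : K × K} (hv : v ≠ 0) (β : OnePoint K) :
    proj v = β ↔ (rep β).2 * v.1 - (rep β).1 * v.2 = 0 := by
  by_cases h : v.2 = 0
  · have h1 : v.1 ≠ 0 := fun h1 ↦ hv (Prod.ext h1 h)
    induction β using OnePoint.rec <;> simp [proj, h, h1]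
  · induction β using OnePoint.rec with
    | infty => simp [proj, h]
    | coe b => simp [proj, h, div_eq_iff h, sub_eq_zero]

lemma proj_eq_zero_iff {v : K × K} (hv : v ≠ 0) : proj v = ((0 : K) : OnePoint K) ↔ v.1 = 0 := by
  simp [proj_eq_iff hv]

lemma exists_eq_smul_rep {v : K × K} (hv : v ≠ 0) : ∃ c : K, c ≠ 0 ∧ v = c • rep (proj v) := by
  by_cases h : v.2 = 0
  · have h1 : v.1 ≠ 0 := fun h1 ↦ hv (Prod.ext h1 h)
    exact ⟨v.1, h1, by simp [proj, h, Prod.ext_iff]⟩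
  · exact ⟨v.2, h, by simp [proj, h, mul_div_cancel₀]⟩

lemma proj_smul {c : K} (hc : c ≠ 0) (v : K × K) : proj (c • v) = proj v := by
  by_cases h : v.2 = 0 <;> simp [proj, h, hc, mul_div_mul_left]

/-- The self-map of the projective line induced by the rational function `g / h` of
degree `d`. -/
noncomputable def ratMap (d : ℕ) (g h : K[X]) (α : OnePoint K) : OnePoint K :=
  proj (lift d g h (rep α))

/-- `g / h` is a rational function of degree `d` in lowest terms. -/
structure IsLowest (d : ℕ) (g h : K[X]) : Prop where
  left_le : g.natDegree ≤ d
  right_le : h.natDegree ≤ d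
  coprime : IsCoprime g h
  coeff_ne : g.coeff d ≠ 0 ∨ h.coeff d ≠ 0

variable {d : ℕ} {g h : K[X]} (H : IsLowest d g h)
include H

lemma IsLowest.lift_rep_ne_zero (α : OnePoint K) : lift d g h (rep α) ≠ 0 := by
  induction α using OnePoint.rec with
  | infty =>
    simp only [lift, rep_infty, homEval_one_zero, Ne, Prod.ext_iff, Algebra.algebraMap_self,
      RingHom.id_apply]
    exact not_and_or.mpr H.coeff_ne
  | coe a =>
    simp only [lift, rep_coe, homEval_right_one H.left_le, homEval_right_one H.right_le, Ne,
      Prod.ext_iff]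
    exact not_and_or.mpr (aeval_ne_zero_of_isCoprime H.coprime a)

omit H in
lemma lift_smul (c : K) (v : K × K) : lift d g h (c • v) = c ^ d • lift d g h v := by
  simp [lift, homEval_mul_left]

lemma IsLowest.lift_ne_zero {v : K × K} (hv : v ≠ 0) : lift d g h v ≠ 0 := by
  obtain ⟨c, hc, h⟩ := exists_eq_smul_rep hv
  rw [h, lift_smul]
  exact smul_ne_zero (pow_ne_zero _ hc) (H.lift_rep_ne_zero _)

omit H in
lemma ratMap_proj {v : K × K} (hv : v ≠ 0) : ratMap d g h (proj v) = proj (lift d g h v) := by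
  obtain ⟨c, hc, h⟩ := exists_eq_smul_rep hv
  conv_rhs => rw [h]
  rw [lift_smul, proj_smul (pow_ne_zero _ hc), ratMap]

lemma IsLowest.iterate_lift_ne_zero {v : K × K} (hv : v ≠ 0) (n : ℕ) :
    (lift d g h)^[n] v ≠ 0 := by
  induction n with
  | zero => exact hv
  | succ n ih => rw [Function.iterate_succ_apply']; exact H.lift_ne_zero ih

lemma IsLowest.iterate_ratMap (n : ℕ) (α : OnePoint K) :
    (ratMap d g h)^[n] α = proj ((lift d g h)^[n] (rep α)) := by
  induction n with
  | zero => simp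
  | succ n ih =>
    rw [Function.iterate_succ_apply', ih, ratMap_proj (H.iterate_lift_ne_zero (rep_ne_zero α) n),
      Function.iterate_succ_apply']

/-- `f⁽ᵐ⁾(α) = β` says that `α` is a zero of the form `y_β Gₘ - x_β Hₘ`. -/
lemma IsLowest.iterate_ratMap_eq_iff (n : ℕ) (α β : OnePoint K) :
    (ratMap d g h)^[n] α = β ↔
      homEval (d ^ n) (C (rep β).2 * (iterPair d g h n).1 - C (rep β).1 * (iterPair d g h n).2)
        (rep α).1 (rep α).2 = 0 := by
  rw [H.iterate_ratMap, proj_eq_iff (H.iterate_lift_ne_zero (rep_ne_zero α) n),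
    lift_iterate, homEval_sub, homEval_C_mul, homEval_C_mul]
  rfl

lemma IsLowest.iterate_ratMap_eq_zero_iff (n : ℕ) (α : OnePoint K) :
    (ratMap d g h)^[n] α = ((0 : K) : OnePoint K) ↔
      homEval (d ^ n) (iterPair d g h n).1 (rep α).1 (rep α).2 = 0 := by
  simp [H.iterate_ratMap_eq_iff]

lemma IsLowest.iterate_ratMap_eq_infty_iff (n : ℕ) (α : OnePoint K) :
    (ratMap d g h)^[n] α = ∞ ↔
      homEval (d ^ n) (iterPair d g h n).2 (rep α).1 (rep α).2 = 0 := by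
  rw [H.iterate_ratMap_eq_iff, homEval_sub]
  simp [homEval]

lemma IsLowest.ratMap_eq_iff (α β : OnePoint K) :
    ratMap d g h α = β ↔
      homEval d (C (rep β).2 * g - C (rep β).1 * h) (rep α).1 (rep α).2 = 0 := by
  rw [ratMap, proj_eq_iff (H.lift_rep_ne_zero α), homEval_sub, homEval_C_mul, homEval_C_mul]
  rfl

omit H in
/-- A binary form of positive degree over an algebraically closed field has a zero. -/
lemma exists_homEval_rep_eq_zero [IsAlgClosed K] (hd : d ≠ 0) {P : K[X]} (hP : P.natDegree ≤ d) :
    ∃ α : OnePoint K, homEval d P (rep α).1 (rep α).2 = 0 := by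
  by_cases hdeg : P.degree = 0
  · refine ⟨∞, ?_⟩
    simp only [rep_infty, homEval_one_zero, Algebra.algebraMap_self, RingHom.id_apply]
    exact coeff_eq_zero_of_natDegree_lt (by
      rw [natDegree_eq_of_degree_eq_some hdeg]; exact Nat.pos_of_ne_zero hd)
  · obtain ⟨a, ha⟩ := IsAlgClosed.exists_root P hdeg
    exact ⟨a, by simpa [homEval_right_one hP] using ha⟩

lemma IsLowest.surjective [IsAlgClosed K] (hd : d ≠ 0) : Function.Surjective (ratMap d g h) := by
  intro β
  have hdeg : (C (rep β).2 * g - C (rep β).1 * h).natDegree ≤ d := by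
    simpa using natDegree_sub_le_of_le ((natDegree_C_mul_le _ _).trans H.left_le)
      ((natDegree_C_mul_le _ _).trans H.right_le)
  obtain ⟨α, hα⟩ := exists_homEval_rep_eq_zero hd hdeg
  exact ⟨α, (H.ratMap_eq_iff α β).2 hα⟩

lemma IsLowest.iterPair_ne_zero [IsAlgClosed K] (hd : d ≠ 0) (n : ℕ) :
    (iterPair d g h n).1 ≠ 0 ∧ (iterPair d g h n).2 ≠ 0 := by
  have hs := (H.surjective hd).iterate n
  constructor <;> intro h0
  · obtain ⟨α, hα⟩ := hs ∞
    have := (H.iterate_ratMap_eq_zero_iff n α).2 (by simp [h0, homEval])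
    rw [hα] at this
    exact infty_ne_coe _ this
  · obtain ⟨α, hα⟩ := hs ((0 : K) : OnePoint K)
    have := (H.iterate_ratMap_eq_infty_iff n α).2 (by simp [h0, homEval])
    rw [hα] at this
    exact coe_ne_infty _ this

end ProjectiveLine

/-! ### Counting fresh preimages -/

section Counting

/-- The fibre of `φ^[m]` over some `β` is mapped by `φ^[n - m]` to `z` or `w`, while none of its
points meets `z` or `w` at a time strictly between `0` and `n`. -/
def HasFreshFibre {S : Type*} (φ : S → S) (z w : S) (n m : ℕ) : Prop :=
  m ≤ n ∧ ∃ β, (φ^[n - m] β = z ∨ φ^[n - m] β = w) ∧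
    ∀ α, φ^[m] α = β → ∀ i, 1 ≤ i → i < n → φ^[i] α ≠ z ∧ φ^[i] α ≠ w

variable {K : Type*} [Field K]

/-- A form vanishing at the point `β` is divisible by the linear form vanishing at `β`. -/
lemma exists_homEval_eq_mul {r : ℕ} {P : K[X]} (hP0 : P ≠ 0) (hP : P.natDegree ≤ r)
    {β : OnePoint K} (hβ : homEval r P (rep β).1 (rep β).2 = 0) :
    0 < r ∧ ∃ Q : K[X], Q.natDegree ≤ r - 1 ∧ ∀ x y : K[X],
      homEval r P x y = (C (rep β).2 * x - C (rep β).1 * y) * homEval (r - 1) Q x y := by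
  induction β using OnePoint.rec with
  | infty =>
    simp only [rep_infty, homEval_one_zero, Algebra.algebraMap_self, RingHom.id_apply] at hβ
    have hlt : P.natDegree < r := lt_of_le_of_ne hP fun h ↦ by
      rw [← h, coeff_natDegree, leadingCoeff_eq_zero] at hβ
      exact hP0 hβ
    have hr : r = (r - 1) + 1 := by omega
    refine ⟨by omega, -P, by rw [natDegree_neg]; omega, fun x y ↦ ?_⟩
    have h1 : homEval 1 (1 : K[X]) x y = y := by simp [homEval]
    have h2 := homEval_mul (m := r - 1) (n := 1) (P := P) (Q := 1) (by omega) (by simp) x y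
    rw [mul_one, ← hr, h1] at h2
    rw [h2, homEval, homEval, homogenize_neg, map_neg]
    simp
    ring
  | coe b =>
    rw [rep_coe, homEval_right_one hP, coe_aeval_eq_eval] at hβ
    obtain ⟨Q, rfl⟩ := dvd_iff_isRoot.2 hβ
    have hQ0 : Q ≠ 0 := right_ne_zero_of_mul hP0
    rw [natDegree_mul (X_sub_C_ne_zero b) hQ0, natDegree_X_sub_C] at hP
    have hr : r = 1 + (r - 1) := by omega
    refine ⟨by omega, Q, by omega, fun x y ↦ ?_⟩
    have h1 : homEval 1 (X - C b) x y = x - C b * y := by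
      have h := homEval_sub 1 X (C b) x y
      rw [h]
      simp [homEval, homogenize_C, homogenize_X]
    have h2 := homEval_mul (m := 1) (n := r - 1) (P := X - C b) (Q := Q)
      (natDegree_X_sub_C b).le (by omega) x y
    rw [← hr, h1] at h2
    rw [h2]
    simp

/-- If `a / b = W P / Q` as forms of degree `N`, and the form `W` of degree `M` has no common zero
with `Q`, then `a / b` has degree at least `M`. Only one of `W` and `Q` can vanish at infinity,
which is the meaning of the last hypothesis. -/
lemma le_max_natDegree {W P Q a b : K[X]} {M N : ℕ} (hab : a * Q = b * (W * P))
    (hcop : IsCoprime W Q) (ha : a ≠ 0) (hQ : Q ≠ 0) (hP : P.natDegree + M ≤ N)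
    (hdeg : W.natDegree = M ∨ Q.natDegree = N) : M ≤ max a.natDegree b.natDegree := by
  obtain ⟨R, rfl⟩ : W ∣ a := hcop.dvd_of_dvd_mul_right ⟨b * P, by rw [hab]; ring⟩
  have hW : W ≠ 0 := left_ne_zero_of_mul ha
  have hR : R ≠ 0 := right_ne_zero_of_mul ha
  rcases hdeg with h | h
  · refine le_max_of_le_left ?_
    rw [natDegree_mul hW hR]
    omega
  · refine le_max_of_le_right ?_
    have h1 : R * Q = b * P := mul_left_cancel₀ hW (by linear_combination hab)
    have h2 := congrArg natDegree h1
    have h3 := natDegree_mul_le (p := b) (q := P)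
    rw [natDegree_mul hR hQ] at h2
    omega

/-- The numerator of `∏ (A i / B i) ^ k i`; the denominator is `powProd B A k n`. -/
noncomputable def powProd (A B : ℕ → K[X]) (k : ℕ → ℤ) (n : ℕ) : K[X] :=
  ∏ i ∈ Finset.Icc 1 n, A i ^ (k i).toNat * B i ^ (-k i).toNat

lemma powProd_neg (A B : ℕ → K[X]) (k : ℕ → ℤ) (n : ℕ) :
    powProd A B (-k) n = powProd B A k n :=
  Finset.prod_congr rfl fun i _ ↦ by simp [mul_comm]

lemma powProd_ne_zero {A B : ℕ → K[X]} (hA : ∀ i, A i ≠ 0) (hB : ∀ i, B i ≠ 0) (k : ℕ → ℤ)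
    (n : ℕ) : powProd A B k n ≠ 0 :=
  Finset.prod_ne_zero_iff.2 fun i _ ↦ mul_ne_zero (pow_ne_zero _ (hA i)) (pow_ne_zero _ (hB i))

lemma powProd_succ (A B : ℕ → K[X]) (k : ℕ → ℤ) (n : ℕ) :
    powProd A B k (n + 1) =
      powProd A B k n * (A (n + 1) ^ (k (n + 1)).toNat * B (n + 1) ^ (-k (n + 1)).toNat) :=
  Finset.prod_Icc_succ_top (by omega) _

lemma natDegree_powProd_le {A B : ℕ → K[X]} {e : ℕ → ℕ} (hA : ∀ i, (A i).natDegree ≤ e i)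
    (hB : ∀ i, (B i).natDegree ≤ e i) (k : ℕ → ℤ) (n : ℕ) :
    (powProd A B k n).natDegree ≤ ∑ i ∈ Finset.Icc 1 n, (k i).natAbs * e i := by
  refine (natDegree_prod_le _ _).trans (Finset.sum_le_sum fun i _ ↦ ?_)
  refine natDegree_mul_le.trans ?_
  refine (add_le_add (natDegree_pow_le_of_le _ (hA i)) (natDegree_pow_le_of_le _ (hB i))).trans ?_
  rw [← add_mul]
  exact Nat.mul_le_mul_right _ (by omega)

lemma natDegree_powProd {A B : ℕ → K[X]} {e : ℕ → ℕ} (hA0 : ∀ i, A i ≠ 0) (hB0 : ∀ i, B i ≠ 0)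
    (k : ℕ → ℤ) (n : ℕ) (hA : ∀ i, 1 ≤ i → i ≤ n → (A i).natDegree = e i)
    (hB : ∀ i, 1 ≤ i → i ≤ n → (B i).natDegree = e i) :
    (powProd A B k n).natDegree = ∑ i ∈ Finset.Icc 1 n, (k i).natAbs * e i := by
  rw [powProd, natDegree_prod _ _ fun i _ ↦
    mul_ne_zero (pow_ne_zero _ (hA0 i)) (pow_ne_zero _ (hB0 i))]
  refine Finset.sum_congr rfl fun i hi ↦ ?_
  rw [Finset.mem_Icc] at hi
  rw [natDegree_mul (pow_ne_zero _ (hA0 i)) (pow_ne_zero _ (hB0 i)), natDegree_pow, natDegree_pow,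
    hA i hi.1 hi.2, hB i hi.1 hi.2, ← add_mul]
  congr 1
  omega

lemma le_max_natDegree_of_powProd {A B : ℕ → K[X]} {e : ℕ → ℕ} {k : ℕ → ℤ} {n M : ℕ}
    {W V a b : K[X]} (hA0 : ∀ i, A i ≠ 0) (hB0 : ∀ i, B i ≠ 0)
    (hA : ∀ i, (A i).natDegree ≤ e i) (hB : ∀ i, (B i).natDegree ≤ e i)
    (hWV : A (n + 1) = W * V) (hV : V.natDegree + M ≤ e (n + 1))
    (hcA : ∀ i, 1 ≤ i → i ≤ n → IsCoprime W (A i))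
    (hcB : ∀ i, 1 ≤ i → i ≤ n + 1 → IsCoprime W (B i))
    (hdeg : W.natDegree = M ∨ (∀ i, 1 ≤ i → i ≤ n → (A i).natDegree = e i) ∧
      ∀ i, 1 ≤ i → i ≤ n + 1 → (B i).natDegree = e i)
    (hk : 0 < k (n + 1)) (ha : a ≠ 0)
    (hab : a * powProd B A k (n + 1) = b * powProd A B k (n + 1)) :
    M ≤ max a.natDegree b.natDegree := by
  obtain ⟨t, ht⟩ : ∃ t : ℕ, k (n + 1) = (t + 1 : ℕ) :=
    ⟨(k (n + 1)).toNat - 1, by omega⟩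
  have hneg : (-((t + 1 : ℕ) : ℤ)).toNat = 0 := by omega
  have hQ : powProd B A k (n + 1) = powProd B A k n * B (n + 1) ^ (t + 1) := by
    rw [powProd_succ, ht, hneg, Int.toNat_natCast, pow_zero, mul_one]
  have hP : powProd A B k (n + 1) = W * (powProd A B k n * V * A (n + 1) ^ t) := by
    rw [powProd_succ, ht, hneg, Int.toNat_natCast, pow_zero, mul_one, pow_succ]
    linear_combination (powProd A B k n * A (n + 1) ^ t) * hWV
  have hN : (∑ i ∈ Finset.Icc 1 n, (k i).natAbs * e i) + (t + 1) * e (n + 1) =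
      ∑ i ∈ Finset.Icc 1 (n + 1), (k i).natAbs * e i := by
    rw [Finset.sum_Icc_succ_top (by omega), ht, Int.natAbs_natCast]
  rw [hP] at hab
  refine le_max_natDegree hab ?_ ha (powProd_ne_zero hB0 hA0 _ _)
    (N := ∑ i ∈ Finset.Icc 1 (n + 1), (k i).natAbs * e i) ?_ ?_
  · rw [hQ]
    refine IsCoprime.mul_right (IsCoprime.prod_right fun i hi ↦ ?_)
      (IsCoprime.pow_right (hcB _ (by omega) le_rfl))
    rw [Finset.mem_Icc] at hi
    exact IsCoprime.mul_right (IsCoprime.pow_right (hcB i hi.1 (by omega)))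
      (IsCoprime.pow_right (hcA i hi.1 hi.2))
  · have h1 := natDegree_powProd_le hA hB k n
    have h2 := natDegree_pow_le_of_le t (hA (n + 1))
    have h3 := (natDegree_mul_le (p := powProd A B k n * V) (q := A (n + 1) ^ t))
    have h4 := (natDegree_mul_le (p := powProd A B k n) (q := V))
    rw [← hN, add_mul]
    omega
  · refine hdeg.imp_right fun h ↦ ?_
    rw [hQ, ← hN, natDegree_mul (powProd_ne_zero hB0 hA0 _ _) (pow_ne_zero _ (hB0 _)),
      natDegree_pow, natDegree_powProd hB0 hA0 k n (fun i h1 h2 ↦ h.2 i h1 (by omega)) h.1,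
      h.2 _ (by omega) le_rfl]

/-- The sign of the last exponent only decides whether the fresh zeros of `A (n + 1)` become zeros
or poles of the product. -/
lemma le_max_natDegree_of_powProd' {A B : ℕ → K[X]} {e : ℕ → ℕ} {k : ℕ → ℤ} {n M : ℕ}
    {W V a b : K[X]} (hA0 : ∀ i, A i ≠ 0) (hB0 : ∀ i, B i ≠ 0)
    (hA : ∀ i, (A i).natDegree ≤ e i) (hB : ∀ i, (B i).natDegree ≤ e i)
    (hWV : A (n + 1) = W * V) (hV : V.natDegree + M ≤ e (n + 1))
    (hcA : ∀ i, 1 ≤ i → i ≤ n → IsCoprime W (A i))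
    (hcB : ∀ i, 1 ≤ i → i ≤ n + 1 → IsCoprime W (B i))
    (hdeg : W.natDegree = M ∨ (∀ i, 1 ≤ i → i ≤ n → (A i).natDegree = e i) ∧
      ∀ i, 1 ≤ i → i ≤ n + 1 → (B i).natDegree = e i)
    (hk : k (n + 1) ≠ 0) (ha : a ≠ 0) (hb : b ≠ 0)
    (hab : a * powProd B A k (n + 1) = b * powProd A B k (n + 1)) :
    M ≤ max a.natDegree b.natDegree := by
  rcases lt_or_gt_of_ne hk with hk | hk
  · rw [max_comm]
    refine le_max_natDegree_of_powProd (k := -k) hA0 hB0 hA hB hWV hV hcA hcB hdeg (by simpa) hb ?_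
    rw [powProd_neg, powProd_neg, hab]
  · exact le_max_natDegree_of_powProd hA0 hB0 hA hB hWV hV hcA hcB hdeg hk ha hab

variable {d : ℕ} {g h : K[X]} (H : IsLowest d g h)
include H

/-- A fibre of `f⁽ᵐ⁾` has `d ^ m` points with multiplicity; if it is fresh, they are zeros or poles
of the product that no other factor cancels. -/
lemma IsLowest.pow_le_max_natDegree [IsAlgClosed K] (hd : d ≠ 0) {n m : ℕ} (hn : 1 ≤ n)
    (hfresh : HasFreshFibre (ratMap d g h) ((0 : K) : OnePoint K) OnePoint.infty n m)
    {k : ℕ → ℤ} (hk : k n ≠ 0) {a b : K[X]} (ha : a ≠ 0) (hb : b ≠ 0)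
    (hab : a * powProd (fun i ↦ (iterPair d g h i).2) (fun i ↦ (iterPair d g h i).1) k n =
      b * powProd (fun i ↦ (iterPair d g h i).1) (fun i ↦ (iterPair d g h i).2) k n) :
    d ^ m ≤ max a.natDegree b.natDegree := by
  obtain ⟨hmn, β, hβ, hfr⟩ := hfresh
  obtain ⟨n, rfl⟩ : ∃ n', n = n' + 1 := ⟨n - 1, by omega⟩
  obtain ⟨r, hr⟩ : ∃ r, n + 1 = r + m := ⟨n + 1 - m, by omega⟩
  have hrm : n + 1 - m = r := by omega
  rw [hrm] at hβ
  have hdeg := natDegree_iterPair_le (d := d) g h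
  have hne := H.iterPair_ne_zero hd
  set W : K[X] := C (rep β).2 * (iterPair d g h m).1 - C (rep β).1 * (iterPair d g h m).2 with hW
  have hWdeg : W.natDegree ≤ d ^ m := by
    simpa using natDegree_sub_le_of_le ((natDegree_C_mul_le (rep β).2 _).trans (hdeg m).1)
      ((natDegree_C_mul_le (rep β).1 _).trans (hdeg m).2)
  -- A point of the fibre over `β`, at infinity or not, is not a zero of a given other form.
  have hcop : ∀ {i : ℕ} {P : K[X]}, P.natDegree ≤ d ^ i →
      (∀ α, (ratMap d g h)^[m] α = β → homEval (d ^ i) P (rep α).1 (rep α).2 ≠ 0) →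
      IsCoprime W P ∧ (W.natDegree = d ^ m ∨ P.natDegree = d ^ i) := by
    intro i P hP hα
    constructor
    · refine (isCoprime_iff_aeval_ne_zero_of_isAlgClosed K K W P).2 fun c ↦ ?_
      by_contra! hc
      refine hα (c : OnePoint K) ((H.iterate_ratMap_eq_iff m c β).2 ?_) ?_
      · rw [rep_coe, homEval_right_one hWdeg]
        exact hc.1
      · rw [rep_coe, homEval_right_one hP]
        exact hc.2
    · refine or_iff_not_imp_left.2 fun hWne ↦ ?_
      have := hα OnePoint.infty ((H.iterate_ratMap_eq_iff m _ β).2 (by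
        rw [rep_infty, homEval_one_zero, ← hW,
          coeff_eq_zero_of_natDegree_lt (lt_of_le_of_ne hWdeg hWne), map_zero]))
      rw [rep_infty, homEval_one_zero] at this
      exact le_antisymm hP (le_natDegree_of_ne_zero (by simpa using this))
  have hfr0 : ∀ i, 1 ≤ i → i ≤ n → IsCoprime W (iterPair d g h i).1 ∧
      (W.natDegree = d ^ m ∨ (iterPair d g h i).1.natDegree = d ^ i) := fun i h1 h2 ↦
    hcop (hdeg i).1 fun α hα h0 ↦ (hfr α hα i h1 (by omega)).1
      ((H.iterate_ratMap_eq_zero_iff i α).2 h0)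
  have hfri : ∀ i, 1 ≤ i → i ≤ n → IsCoprime W (iterPair d g h i).2 ∧
      (W.natDegree = d ^ m ∨ (iterPair d g h i).2.natDegree = d ^ i) := fun i h1 h2 ↦
    hcop (hdeg i).2 fun α hα h0 ↦ (hfr α hα i h1 (by omega)).2
      ((H.iterate_ratMap_eq_infty_iff i α).2 h0)
  have hlast : ∀ α, (ratMap d g h)^[m] α = β →
      (ratMap d g h)^[n + 1] α = (ratMap d g h)^[r] β := fun α hα ↦ by
    rw [hr, Function.iterate_add_apply, hα]
  have hpow : d ^ r * d ^ m = d ^ (n + 1) := by rw [hr, pow_add]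
  have hfactor : ∀ P : K[X], P ≠ 0 → P.natDegree ≤ d ^ r →
      homEval (d ^ r) P (rep β).1 (rep β).2 = 0 →
      ∃ V : K[X], homEval (d ^ r) P (iterPair d g h m).1 (iterPair d g h m).2 = W * V ∧
        V.natDegree + d ^ m ≤ d ^ (n + 1) := by
    intro P hP0 hP h0
    obtain ⟨hpos, Q, hQ, hQe⟩ := exists_homEval_eq_mul hP0 hP h0
    refine ⟨_, hQe _ _, (add_le_add_left (natDegree_homEval_le (hdeg m).1 (hdeg m).2) _).trans ?_⟩
    rw [← hpow, mul_comm (d ^ m), ← Nat.succ_mul]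
    exact Nat.mul_le_mul_right _ (by omega)
  rcases hβ with hβ | hβ
  · obtain ⟨V, hV, hVd⟩ := hfactor _ (hne r).1 (hdeg r).1 ((H.iterate_ratMap_eq_zero_iff r β).1 hβ)
    have hB := hcop (hdeg (n + 1)).2 fun α hα h0 ↦ by
      have := (H.iterate_ratMap_eq_infty_iff (n + 1) α).2 h0
      rw [hlast α hα, hβ] at this
      exact OnePoint.coe_ne_infty _ this
    refine le_max_natDegree_of_powProd' (e := fun i ↦ d ^ i) (W := W) (V := V) (fun i ↦ (hne i).1)
      (fun i ↦ (hne i).2) (fun i ↦ (hdeg i).1) (fun i ↦ (hdeg i).2) ?_ hVd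
      (fun i h1 h2 ↦ (hfr0 i h1 h2).1) (fun i h1 h2 ↦ ?_) ?_ hk ha hb hab
    · simp only [← hV, hr, iterPair_add]
    · rcases h2.lt_or_eq with h2 | rfl
      exacts [(hfri i h1 (by omega)).1, hB.1]
    · refine or_iff_not_imp_left.2 fun hWne ↦ ⟨fun i h1 h2 ↦ (hfr0 i h1 h2).2.resolve_left hWne,
        fun i h1 h2 ↦ ?_⟩
      rcases h2.lt_or_eq with h2 | rfl
      exacts [(hfri i h1 (by omega)).2.resolve_left hWne, hB.2.resolve_left hWne]
  · obtain ⟨V, hV, hVd⟩ := hfactor _ (hne r).2 (hdeg r).2 ((H.iterate_ratMap_eq_infty_iff r β).1 hβ)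
    have hB := hcop (hdeg (n + 1)).1 fun α hα h0 ↦ by
      have := (H.iterate_ratMap_eq_zero_iff (n + 1) α).2 h0
      rw [hlast α hα, hβ] at this
      exact OnePoint.infty_ne_coe _ this
    rw [max_comm]
    refine le_max_natDegree_of_powProd' (e := fun i ↦ d ^ i) (W := W) (V := V) (fun i ↦ (hne i).2)
      (fun i ↦ (hne i).1) (fun i ↦ (hdeg i).2) (fun i ↦ (hdeg i).1) ?_ hVd
      (fun i h1 h2 ↦ (hfri i h1 h2).1) (fun i h1 h2 ↦ ?_) ?_ hk hb ha hab.symm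
    · simp only [← hV, hr, iterPair_add]
    · rcases h2.lt_or_eq with h2 | rfl
      exacts [(hfr0 i h1 (by omega)).1, hB.1]
    · refine or_iff_not_imp_left.2 fun hWne ↦ ⟨fun i h1 h2 ↦ (hfri i h1 h2).2.resolve_left hWne,
        fun i h1 h2 ↦ ?_⟩
      rcases h2.lt_or_eq with h2 | rfl
      exacts [(hfr0 i h1 (by omega)).2.resolve_left hWne, hB.2.resolve_left hWne]

end Counting

/-! ### Orbits of two marked points -/

section Orbits

variable {S : Type*} {φ : S → S} {z w : S}

/-- Every orbit segment of positive length from `z` or `w` to `t` has length at least `b`, and is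
at `s` exactly `b` steps before its end. -/
def EntersThrough (φ : S → S) (z w t s : S) (b : ℕ) : Prop :=
  ∀ u, u = z ∨ u = w → ∀ k, 1 ≤ k → φ^[k] u = t → b ≤ k ∧ φ^[k - b] u = s

/-- `x` is the only preimage of its image. -/
def UniquePreimage (φ : S → S) (x : S) : Prop :=
  ∀ y, φ y = φ x → y = x

lemma EntersThrough.hasFreshFibre_self {t s : S} {b : ℕ} (h : EntersThrough φ z w t s b)
    (ht : t = z ∨ t = w) {n : ℕ} (hn : n ≤ b) : HasFreshFibre φ z w n n := by
  refine ⟨le_rfl, t, by simpa using ht, fun α hα i h1 h2 ↦ ?_⟩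
  by_contra hcon
  have hu : φ^[i] α = z ∨ φ^[i] α = w := by tauto
  have := (h _ hu (n - i) (by omega) (by
    rw [← Function.iterate_add_apply, Nat.sub_add_cancel h2.le, hα])).1
  omega

lemma hasFreshFibre_self_of_not_reached {t : S} (ht : t = z ∨ t = w)
    (h : ∀ u, u = z ∨ u = w → ∀ k, 1 ≤ k → φ^[k] u ≠ t) (n : ℕ) : HasFreshFibre φ z w n n :=
  EntersThrough.hasFreshFibre_self (b := n) (s := t)
    (fun u hu k hk hkt ↦ absurd hkt (h u hu k hk)) ht le_rfl

/-- The fibre over `β` avoids all orbits coming from `z` or `w`, which pass through `s` at the time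
when they would have to be at `β`. -/
lemma EntersThrough.hasFreshFibre_sub {t s β : S} {b : ℕ} (h : EntersThrough φ z w t s b)
    (ht : t = z ∨ t = w) (hβ : φ^[b] β = t) (hs : β ≠ s) {n : ℕ} (hn : b ≤ n) :
    HasFreshFibre φ z w n (n - b) := by
  refine ⟨Nat.sub_le _ _, β, by rw [Nat.sub_sub_self hn, hβ]; exact ht, fun α hα i h1 h2 ↦ ?_⟩
  by_contra hcon
  have hu : φ^[i] α = z ∨ φ^[i] α = w := by tauto
  have hα' : φ^[n] α = t := by
    rw [← hβ, ← hα, ← Function.iterate_add_apply, Nat.add_sub_cancel' hn]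
  obtain ⟨h3, h4⟩ := h _ hu (n - i) (by omega) (by
    rw [← Function.iterate_add_apply, Nat.sub_add_cancel h2.le, hα'])
  rw [← Function.iterate_add_apply, show n - i - b + i = n - b by omega, hα] at h4
  exact hs h4

/-- If `s` is the only point of the fibre of `φ^[b]` over `t`, no branching occurs on the way. -/
lemma uniquePreimage_of_iterate (hφ : Function.Surjective φ) {t s : S} {b : ℕ}
    (h : ∀ β, φ^[b] β = t → β = s) {i : ℕ} (hi : i < b) :
    UniquePreimage φ (φ^[i] s) := by
  intro γ hγ
  obtain ⟨δ, rfl⟩ := hφ.iterate i γ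
  obtain ⟨β, hβ⟩ := hφ.iterate b t
  obtain rfl := h β hβ
  rw [h δ]
  rw [← hβ, show b = (b - i - 1) + 1 + i by omega]
  simp only [Function.iterate_add_apply _ _ i, Function.iterate_succ_apply _ (b - i - 1)]
  rw [hγ]

/-- If `z` has period `e` and is not reached from `w`, every orbit enters `z` through `z`. -/
lemma entersThrough_of_separate {e : ℕ} (he : φ^[e] z = z)
    (hmin : ∀ k, 1 ≤ k → φ^[k] z = z → e ≤ k) (hw : ∀ k, 1 ≤ k → φ^[k] w ≠ z) :
    EntersThrough φ z w z z e := by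
  rintro u (rfl | rfl) k hk hku
  · have hek := hmin k hk hku
    refine ⟨hek, ?_⟩
    rwa [← Nat.sub_add_cancel hek, Function.iterate_add_apply, he] at hku
  · exact absurd hku (hw k hk)

lemma EntersThrough.swap {t s : S} {b : ℕ} (h : EntersThrough φ z w t s b) :
    EntersThrough φ w z t s b := fun u hu ↦ h u hu.symm

/-- If `z` and `w` are on one cycle, every orbit enters `z` through `w`, at distance `b`. -/
lemma entersThrough_of_common (hzw : z ≠ w) {a b : ℕ} (ha : φ^[a] z = w)
    (hamin : ∀ k, 1 ≤ k → φ^[k] z = w → a ≤ k) (hb : φ^[b] w = z)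
    (hbmin : ∀ k, 1 ≤ k → φ^[k] w = z → b ≤ k) : EntersThrough φ z w z w b := by
  have key : ∀ k, 1 ≤ k → φ^[k] w = z → b ≤ k ∧ φ^[k - b] w = w := by
    intro k hk hkw
    have hbk := hbmin k hk hkw
    refine ⟨hbk, ?_⟩
    have h1 : φ^[k - b] z = z := by
      rwa [← Nat.sub_add_cancel hbk, Function.iterate_add_apply, hb] at hkw
    rw [← ha, ← Function.iterate_add_apply, add_comm, Function.iterate_add_apply, h1]
  rintro u (rfl | rfl) k hk hku
  · have hak : a < k := by
      by_contra! hka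
      rcases hka.eq_or_lt with rfl | hka
      · exact hzw (hku.symm.trans ha)
      · have h1 : φ^[a - k] u = w := by
          rwa [← Nat.sub_add_cancel hka.le, Function.iterate_add_apply, hku] at ha
        have := hamin _ (by omega) h1
        omega
    have h1 : φ^[k - a] w = u := by
      rwa [← Nat.sub_add_cancel hak.le, Function.iterate_add_apply, ha] at hku
    obtain ⟨h2, h3⟩ := key _ (by omega) h1
    refine ⟨by omega, ?_⟩
    rw [show k - b = (k - a - b) + a by omega, Function.iterate_add_apply, ha, h3]
  · exact key k hk hku

lemma exists_least_iterate_eq {x y : S} (h : ∃ k, 1 ≤ k ∧ φ^[k] x = y) :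
    ∃ k, 1 ≤ k ∧ φ^[k] x = y ∧ ∀ l, 1 ≤ l → φ^[l] x = y → k ≤ l := by
  classical
  exact ⟨Nat.find h, (Nat.find_spec h).1, (Nat.find_spec h).2,
    fun l h1 h2 ↦ Nat.find_min' h ⟨h1, h2⟩⟩

lemma EntersThrough.exists_hasFreshFibre_or {t s : S} {b : ℕ} (h : EntersThrough φ z w t s b)
    (ht : t = z ∨ t = w) :
    (∃ j, ∀ n, (n ≤ j → HasFreshFibre φ z w n n) ∧ (j < n → HasFreshFibre φ z w n (n - j))) ∨
      ∀ β, φ^[b] β = t → β = s := by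
  by_cases hβ : ∀ β, φ^[b] β = t → β = s
  · exact .inr hβ
  · push Not at hβ
    obtain ⟨β, h1, h2⟩ := hβ
    exact .inl ⟨b, fun n ↦ ⟨fun hn ↦ h.hasFreshFibre_self ht hn,
      fun hn ↦ h.hasFreshFibre_sub ht h1 h2 hn.le⟩⟩

/-- If `z` and `w` are both reached from `{z, w}`, they are periodic, on one cycle or on two. The
only obstruction to fresh fibres is then that no point of these cycles has a second preimage. -/
theorem exists_hasFreshFibre_or_uniquePreimage (hφ : Function.Surjective φ) (hzw : z ≠ w)
    (hw : φ w ≠ w) :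
    (∃ j, ∀ n, (n ≤ j → HasFreshFibre φ z w n n) ∧ (j < n → HasFreshFibre φ z w n (n - j))) ∨
      UniquePreimage φ z ∧ UniquePreimage φ w ∧
        ((∃ c, c ≠ z ∧ c ≠ w ∧ UniquePreimage φ c) ∨ φ z = w ∧ φ w = z) := by
  have hfree : ∀ t, t = z ∨ t = w → (∀ u, u = z ∨ u = w → ∀ k, 1 ≤ k → φ^[k] u ≠ t) →
      ∃ j, ∀ n, (n ≤ j → HasFreshFibre φ z w n n) ∧
        (j < n → HasFreshFibre φ z w n (n - j)) := fun t ht h ↦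
    ⟨0, fun n ↦ ⟨fun _ ↦ hasFreshFibre_self_of_not_reached ht h n,
      fun _ ↦ hasFreshFibre_self_of_not_reached ht h n⟩⟩
  have htrans : ∀ {x y v : S}, (∃ k, 1 ≤ k ∧ φ^[k] x = y) → (∃ k, 1 ≤ k ∧ φ^[k] x = v) →
      (∃ k, 1 ≤ k ∧ φ^[k] x = x) → ∃ k, 1 ≤ k ∧ φ^[k] y = v := by
    -- On the cycle of `x`, go from `y` on to `v` after sufficiently many turns.
    rintro x y v ⟨k, hk, rfl⟩ ⟨l, hl, rfl⟩ ⟨e, he, hex⟩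
    have hx : ∀ q, φ^[e * q] x = x := fun q ↦
      (show Function.IsPeriodicPt φ e x from hex).mul_const q
    have hle : k ≤ e * k := Nat.le_mul_of_pos_left k he
    refine ⟨l + (e * k - k), by omega, ?_⟩
    rw [← Function.iterate_add_apply, add_assoc, Nat.sub_add_cancel hle,
      Function.iterate_add_apply, hx]
  by_cases hzr : ∀ u, u = z ∨ u = w → ∀ k, 1 ≤ k → φ^[k] u ≠ z
  · exact .inl (hfree z (.inl rfl) hzr)
  by_cases hwr : ∀ u, u = z ∨ u = w → ∀ k, 1 ≤ k → φ^[k] u ≠ w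
  · exact .inl (hfree w (.inr rfl) hwr)
  have hz' : (∃ k, 1 ≤ k ∧ φ^[k] z = z) ∨ ∃ k, 1 ≤ k ∧ φ^[k] w = z := by
    push Not at hzr
    obtain ⟨u, rfl | rfl, h⟩ := hzr
    exacts [.inl h, .inr h]
  have hw' : (∃ k, 1 ≤ k ∧ φ^[k] z = w) ∨ ∃ k, 1 ≤ k ∧ φ^[k] w = w := by
    push Not at hwr
    obtain ⟨u, rfl | rfl, h⟩ := hwr
    exacts [.inl h, .inr h]
  by_cases hzw1 : ∃ k, 1 ≤ k ∧ φ^[k] z = w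
  · have hwz1 : ∃ k, 1 ≤ k ∧ φ^[k] w = z := hz'.elim (fun h ↦ htrans hzw1 h h) id
    obtain ⟨a, ha1, ha, hamin⟩ := exists_least_iterate_eq hzw1
    obtain ⟨b, hb1, hb, hbmin⟩ := exists_least_iterate_eq hwz1
    rcases (entersThrough_of_common hzw ha hamin hb hbmin).exists_hasFreshFibre_or (.inl rfl)
      with h | hbu
    · exact .inl h
    rcases (entersThrough_of_common hzw.symm hb hbmin ha hamin).swap.exists_hasFreshFibre_or
      (.inr rfl) with h | hau
    · exact .inl h
    have hzu : UniquePreimage φ z := uniquePreimage_of_iterate hφ hau ha1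
    have hwu : UniquePreimage φ w := uniquePreimage_of_iterate hφ hbu hb1
    refine .inr ⟨hzu, hwu, ?_⟩
    by_cases hwz : φ w = z
    · by_cases hzw2 : φ z = w
      · exact .inr ⟨hzw2, hwz⟩
      · refine .inl ⟨φ z, fun h ↦ hzw (hwu z (h.trans hwz.symm)), hzw2, ?_⟩
        refine uniquePreimage_of_iterate hφ hau (i := 1) (lt_of_le_of_ne ha1 ?_)
        rintro rfl
        exact hzw2 ha
    · refine .inl ⟨φ w, hwz, hw, ?_⟩
      refine uniquePreimage_of_iterate hφ hbu (i := 1) (lt_of_le_of_ne hb1 ?_)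
      rintro rfl
      exact hwz hb
  · have hww1 := hw'.resolve_left hzw1
    have hwz1 : ¬ ∃ k, 1 ≤ k ∧ φ^[k] w = z := fun h ↦
      hzw1 (htrans h hww1 hww1)
    have hzz1 := hz'.resolve_right hwz1
    push Not at hzw1 hwz1
    obtain ⟨a, ha1, ha, hamin⟩ := exists_least_iterate_eq hzz1
    obtain ⟨b, hb1, hb, hbmin⟩ := exists_least_iterate_eq hww1
    rcases (entersThrough_of_separate ha hamin hwz1).exists_hasFreshFibre_or (.inl rfl)
      with h | hau
    · exact .inl h
    rcases (entersThrough_of_separate hb hbmin hzw1).swap.exists_hasFreshFibre_or (.inr rfl)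
      with h | hbu
    · exact .inl h
    refine .inr ⟨uniquePreimage_of_iterate hφ hau ha1, uniquePreimage_of_iterate hφ hbu hb1,
      .inl ⟨φ w, hwz1 1 le_rfl, hw, ?_⟩⟩
    refine uniquePreimage_of_iterate hφ hbu (i := 1) (lt_of_le_of_ne hb1 ?_)
    rintro rfl
    exact hw hb

lemma entersThrough_of_fixed (hzw : z ≠ w) (hw : φ w = w) {e : ℕ} (he : φ^[e] z = z)
    (hmin : ∀ k, 1 ≤ k → φ^[k] z = z → e ≤ k) :
    EntersThrough φ z w z z e :=
  entersThrough_of_separate he hmin fun k _ h ↦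
    hzw (h.symm.trans (Function.iterate_fixed hw k))

/-- Use preimages of `w` if `z` never reaches `w`, and preimages of `z` otherwise, since `z` is then
not periodic. -/
theorem hasFreshFibre_of_fixed_of_preimage (hzw : z ≠ w) (hw : φ w = w) {β : S} (hβ : φ β = w)
    (hβw : β ≠ w) {n : ℕ} (hn : 1 ≤ n) :
    HasFreshFibre φ z w n n ∨ HasFreshFibre φ z w n (n - 1) := by
  have hwk : ∀ k, φ^[k] w = w := fun k ↦ Function.iterate_fixed hw k
  by_cases hz : ∃ k, φ^[k] z = w
  · refine .inl (hasFreshFibre_self_of_not_reached (.inl rfl) ?_ n)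
    rintro u (rfl | rfl) k hk hku
    · obtain ⟨l, hl⟩ := hz
      have h1 : φ^[k * l] u = u := (show Function.IsPeriodicPt φ k u from hku).mul_const l
      have h2 : φ^[k * l] u = w := by
        rw [← Nat.sub_add_cancel (Nat.le_mul_of_pos_left l hk), Function.iterate_add_apply, hl, hwk]
      exact hzw (h1.symm.trans h2)
    · exact hzw (hku.symm.trans (hwk k))
  · push Not at hz
    refine .inr (EntersThrough.hasFreshFibre_sub (b := 1) (t := w) (s := w) ?_ (.inr rfl) hβ hβw hn)
    rintro u (rfl | rfl) k hk hku
    · exact absurd hku (hz k)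
    · exact ⟨hk, hwk _⟩

/-- Use preimages of `w` if `z` is periodic and its cycle misses `w`, and preimages of `z`
otherwise. -/
theorem hasFreshFibre_of_map_eq_of_preimage (hzw : z ≠ w) (hw : φ w = z) {β : S} (hβ : φ β = z)
    (hβw : β ≠ w) {n : ℕ} (hn : 1 ≤ n) :
    HasFreshFibre φ z w n n ∨ HasFreshFibre φ z w n (n - 1) := by
  have hwk : ∀ k, φ^[k + 1] w = φ^[k] z := fun k ↦ by rw [Function.iterate_succ_apply, hw]
  by_cases hz : ∃ k, 1 ≤ k ∧ φ^[k] z = z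
  · by_cases hzw' : ∃ k, 1 ≤ k ∧ φ^[k] z = w
    · obtain ⟨a, -, ha, hamin⟩ := exists_least_iterate_eq hzw'
      exact .inr ((entersThrough_of_common hzw ha hamin (b := 1) hw
        fun k hk _ ↦ hk).hasFreshFibre_sub (.inl rfl) hβ hβw hn)
    · push Not at hzw'
      refine .inl (hasFreshFibre_self_of_not_reached (.inr rfl) ?_ n)
      rintro u (rfl | rfl) k hk hku
      · exact hzw' k hk hku
      · obtain ⟨k, rfl⟩ : ∃ k', k = k' + 1 := ⟨k - 1, by omega⟩
        rw [hwk] at hku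
        rcases k.eq_zero_or_pos with rfl | hk0
        · exact hzw hku
        · exact hzw' k hk0 hku
  · push Not at hz
    refine .inr (EntersThrough.hasFreshFibre_sub (b := 1) (t := z) (s := w) ?_ (.inl rfl) hβ hβw hn)
    rintro u (rfl | rfl) k hk hku
    · exact absurd hku (hz k hk)
    · obtain ⟨k, rfl⟩ : ∃ k', k = k' + 1 := ⟨k - 1, by omega⟩
      rw [hwk] at hku
      rcases k.eq_zero_or_pos with rfl | hk0
      · exact ⟨le_rfl, rfl⟩
      · exact absurd hku (hz k hk0)

end Orbits

/-! ### Iterates of a rational function as quotients of polynomials -/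

section RationalFunctions

variable {F : Type*} [Field F]

lemma homEval_eq_pow_mul {L : Type*} [Field L] [Algebra F L] {d : ℕ} {P : F[X]}
    (hP : P.natDegree ≤ d) (x : L) {y : L} (hy : y ≠ 0) :
    homEval d P x y = y ^ d * aeval (x / y) P := by
  have := homEval_mul_left d P y (x / y) 1
  rwa [mul_div_cancel₀ _ hy, mul_one, homEval_right_one hP] at this

lemma comp_div {f : RatFunc F} {d : ℕ} (hg : f.num.natDegree ≤ d) (hh : f.denom.natDegree ≤ d)
    {P Q : F[X]} (hQ : Q ≠ 0) :
    comp f (algebraMap F[X] (RatFunc F) P / algebraMap F[X] (RatFunc F) Q) =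
      algebraMap F[X] (RatFunc F) (homEval d f.num P Q) /
        algebraMap F[X] (RatFunc F) (homEval d f.denom P Q) := by
  have hQ' : algebraMap F[X] (RatFunc F) Q ≠ 0 := RatFunc.algebraMap_ne_zero hQ
  have h := fun R ↦ map_homEval (IsScalarTower.toAlgHom F F[X] (RatFunc F)) d R P Q
  simp only [IsScalarTower.coe_toAlgHom'] at h
  rw [h, h, homEval_eq_pow_mul hg _ hQ', homEval_eq_pow_mul hh _ hQ',
    mul_div_mul_left _ _ (pow_ne_zero _ hQ'), comp, RatFunc.eval]
  rfl

variable {f : RatFunc F} {d : ℕ} (hd : degree f = d)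
include hd

lemma natDegree_num_le : f.num.natDegree ≤ d := hd ▸ le_max_left _ _

lemma natDegree_denom_le : f.denom.natDegree ≤ d := hd ▸ le_max_right _ _

variable (K : Type*) [Field K] [Algebra F K]

lemma isLowest_map :
    IsLowest d (f.num.map (algebraMap F K)) (f.denom.map (algebraMap F K)) where
  left_le := by rw [natDegree_map]; exact natDegree_num_le hd
  right_le := by rw [natDegree_map]; exact natDegree_denom_le hd
  coprime := (RatFunc.isCoprime_num_denom f).map (mapRingHom (algebraMap F K))
  coeff_ne := by
    simp only [coeff_map, Ne, map_eq_zero]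
    rcases max_choice f.num.natDegree f.denom.natDegree with h | h
    · rcases eq_or_ne f.num 0 with h0 | h0
      · refine .inr fun h1 ↦ f.denom_ne_zero ?_
        have : d = 0 := by rw [← hd, degree, h, h0, natDegree_zero]
        have h2 := natDegree_denom_le hd
        rw [this, Nat.le_zero] at h2
        rwa [this, ← h2, coeff_natDegree, leadingCoeff_eq_zero] at h1
      · left
        rw [← hd, degree, h, coeff_natDegree, leadingCoeff_eq_zero]
        exact h0
    · right
      rw [← hd, degree, h, coeff_natDegree, leadingCoeff_eq_zero]
      exact f.denom_ne_zero

/-- The self-map of the projective line over the extension `K` of `F` induced by `f`. -/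
noncomputable abbrev pointMap (f : RatFunc F) (d : ℕ) (K : Type*) [Field K] [Algebra F K] :
    OnePoint K → OnePoint K :=
  ratMap d (f.num.map (algebraMap F K)) (f.denom.map (algebraMap F K))

variable (hd0 : d ≠ 0)
include hd0

lemma iterPair_num_denom_ne_zero (n : ℕ) :
    (iterPair d f.num f.denom n).1 ≠ 0 ∧ (iterPair d f.num f.denom n).2 ≠ 0 := by
  have := (isLowest_map hd (AlgebraicClosure F)).iterPair_ne_zero hd0 n
  rw [map_iterPair] at this
  exact ⟨fun h ↦ this.1 (by simp [h]), fun h ↦ this.2 (by simp [h])⟩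

lemma iter_eq_div (n : ℕ) :
    iter f n = algebraMap F[X] (RatFunc F) (iterPair d f.num f.denom n).1 /
      algebraMap F[X] (RatFunc F) (iterPair d f.num f.denom n).2 := by
  induction n with
  | zero => simp [iter, iterPair]
  | succ n ih =>
    rw [iter, ih, comp_div (natDegree_num_le hd) (natDegree_denom_le hd)
      (iterPair_num_denom_ne_zero hd hd0 n).2, iterPair_succ]
    rfl

lemma num_iter_eval_zero_iff (n : ℕ) :
    (iter f n).num.eval 0 = 0 ↔
      (pointMap f d K)^[n] ((0 : K) : OnePoint K) = ((0 : K) : OnePoint K) := by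
  have H := isLowest_map hd K
  have hdeg := natDegree_iterPair_le (d := d) f.num f.denom n
  have hne := iterPair_num_denom_ne_zero hd hd0 n
  have heval : ∀ P : F[X], P.natDegree ≤ d ^ n →
      (homEval (d ^ n) (P.map (algebraMap F K)) (0 : K) 1 = 0 ↔ P.eval 0 = 0) := fun P hP ↦ by
    rw [homEval_zero_one, coeff_map, coeff_zero_eq_eval_zero]
    simp
  have h1 := H.iterate_ratMap_eq_zero_iff n ((0 : K) : OnePoint K)
  have h2 := H.iterate_ratMap_eq_infty_iff n ((0 : K) : OnePoint K)
  rw [map_iterPair, rep_coe, heval _ hdeg.1] at h1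
  rw [map_iterPair, rep_coe, heval _ hdeg.2] at h2
  rw [h1]
  have hmul : (iter f n).num * (iterPair d f.num f.denom n).2 =
      (iterPair d f.num f.denom n).1 * (iter f n).denom := by
    rw [iter_eq_div hd hd0]
    exact RatFunc.num_mul_eq_mul_denom_iff hne.2 |>.2 rfl
  have hev := congrArg (eval 0) hmul
  rw [eval_mul, eval_mul] at hev
  constructor <;> intro h
  · rw [h, zero_mul] at hev
    refine (mul_eq_zero.1 hev.symm).resolve_right fun h0 ↦ ?_
    obtain ⟨u, v, huv⟩ := RatFunc.isCoprime_num_denom (iter f n)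
    have := congrArg (eval 0) huv
    simp [h, h0] at this
  · rw [h, zero_mul] at hev
    refine (mul_eq_zero.1 hev).resolve_right fun h0 ↦ ?_
    have h3 := h1.2 h
    rw [h2.2 h0] at h3
    exact OnePoint.infty_ne_coe _ h3

/-- The degree bound for products of iterates given by a fresh fibre over an algebraically closed
extension. -/
lemma pow_le_Psi [IsAlgClosed K] {n m : ℕ} (hn : 1 ≤ n)
    (h : HasFreshFibre (pointMap f d K) ((0 : K) : OnePoint K) OnePoint.infty n m) :
    d ^ m ≤ Psi f n := by
  refine le_csInf ⟨_, fun _ ↦ 1, one_ne_zero, rfl⟩ ?_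
  rintro _ ⟨k, hk, rfl⟩
  have H := isLowest_map hd K
  have hne := iterPair_num_denom_ne_zero hd hd0
  set G : ℕ → F[X] := fun i ↦ (iterPair d f.num f.denom i).1 with hG
  set E : ℕ → F[X] := fun i ↦ (iterPair d f.num f.denom i).2 with hE
  have hG0 : ∀ i, G i ≠ 0 := fun i ↦ (hne i).1
  have hE0 : ∀ i, E i ≠ 0 := fun i ↦ (hne i).2
  have hprod : ∏ i ∈ Finset.Icc 1 n, iter f i ^ k i =
      algebraMap F[X] (RatFunc F) (powProd G E k n) /
        algebraMap F[X] (RatFunc F) (powProd E G k n) := by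
    simp only [powProd, map_prod, ← Finset.prod_div_distrib]
    refine Finset.prod_congr rfl fun i _ ↦ ?_
    have hGi : algebraMap F[X] (RatFunc F) (G i) ≠ 0 := RatFunc.algebraMap_ne_zero (hG0 i)
    have hEi : algebraMap F[X] (RatFunc F) (E i) ≠ 0 := RatFunc.algebraMap_ne_zero (hE0 i)
    rw [iter_eq_div hd hd0]
    change (algebraMap F[X] (RatFunc F) (G i) / algebraMap F[X] (RatFunc F) (E i)) ^ k i = _
    simp only [map_mul, map_pow]
    rcases le_total 0 (k i) with h0 | h0
    · obtain ⟨t, ht⟩ := Int.eq_ofNat_of_zero_le h0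
      have : (-(t : ℤ)).toNat = 0 := by omega
      rw [ht, this]
      simp [div_pow]
    · obtain ⟨t, ht⟩ := Int.exists_eq_neg_ofNat h0
      have : (-(t : ℤ)).toNat = 0 := by omega
      rw [ht, this]
      simp [div_pow]
  rw [hprod]
  set u := algebraMap F[X] (RatFunc F) (powProd G E k n) /
        algebraMap F[X] (RatFunc F) (powProd E G k n) with hu
  have hu0 : u ≠ 0 := div_ne_zero (RatFunc.algebraMap_ne_zero (powProd_ne_zero hG0 hE0 k n))
    (RatFunc.algebraMap_ne_zero (powProd_ne_zero hE0 hG0 k n))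
  have hmul : u.num * powProd E G k n = u.denom * powProd G E k n := by
    rw [mul_comm u.denom]
    exact RatFunc.num_mul_eq_mul_denom_iff (powProd_ne_zero hE0 hG0 k n) |>.2 rfl
  have hinj := map_injective (algebraMap F K) (algebraMap F K).injective
  have hmap : ∀ A B : ℕ → F[X], (powProd A B k n).map (algebraMap F K) =
      powProd (fun i ↦ (A i).map (algebraMap F K)) (fun i ↦ (B i).map (algebraMap F K)) k n :=
    fun A B ↦ by simp [powProd, Polynomial.map_prod]
  have := H.pow_le_max_natDegree hd0 hn h hk (a := u.num.map (algebraMap F K))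
    (b := u.denom.map (algebraMap F K))
    ((Polynomial.map_ne_zero_iff (algebraMap F K).injective).2 (RatFunc.num_ne_zero hu0))
    ((Polynomial.map_ne_zero_iff (algebraMap F K).injective).2 u.denom_ne_zero) (by
      simp only [map_iterPair]
      rw [← hmap E G, ← hmap G E, ← Polynomial.map_mul, ← Polynomial.map_mul, hmul])
  rwa [natDegree_map, natDegree_map] at this

end RationalFunctions

/-! ### Points with a unique preimage -/

section Ramification

variable {K : Type*} [Field K] {d : ℕ} {g h : K[X]} (H : IsLowest d g h)

include H

omit H in
lemma ratMap_infty_eq_infty_iff : ratMap d g h OnePoint.infty = OnePoint.infty ↔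
    h.coeff d = 0 := by
  rw [ratMap, proj_eq_infty_iff]
  simp [lift, homEval_one_zero]

lemma IsLowest.ratMap_infty_eq_zero_iff :
    ratMap d g h OnePoint.infty = ((0 : K) : OnePoint K) ↔ g.coeff d = 0 := by
  rw [ratMap, proj_eq_zero_iff (H.lift_rep_ne_zero _)]
  simp [lift, homEval_one_zero]

lemma IsLowest.ratMap_coe_eq_infty_iff (c : K) :
    ratMap d g h (c : OnePoint K) = OnePoint.infty ↔ h.eval c = 0 := by
  rw [ratMap, proj_eq_infty_iff]
  simp [lift, homEval_right_one H.right_le]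

lemma IsLowest.ratMap_coe_eq_zero_iff (c : K) :
    ratMap d g h (c : OnePoint K) = ((0 : K) : OnePoint K) ↔ g.eval c = 0 := by
  rw [ratMap, proj_eq_zero_iff (H.lift_rep_ne_zero _)]
  simp [lift, homEval_right_one H.left_le]

/-- The form cutting out the fibre through `β` is the one determined by the lift of `β`. -/
lemma IsLowest.ratMap_eq_ratMap_iff (α β : OnePoint K) :
    ratMap d g h α = ratMap d g h β ↔
      homEval d (C (lift d g h (rep β)).2 * g - C (lift d g h (rep β)).1 * h)
        (rep α).1 (rep α).2 = 0 := by
  obtain ⟨c, hc, hβ⟩ := exists_eq_smul_rep (H.lift_rep_ne_zero β)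
  rw [H.ratMap_eq_iff, ratMap, homEval_sub, homEval_sub, homEval_C_mul, homEval_C_mul,
    homEval_C_mul, homEval_C_mul]
  set v := rep (proj (lift d g h (rep β)))
  rw [hβ]
  simp only [Prod.smul_fst, Prod.smul_snd, smul_eq_mul, Algebra.algebraMap_self, RingHom.id_apply]
  rw [mul_assoc, mul_assoc, ← mul_sub, mul_eq_zero, or_iff_right hc]

lemma IsLowest.natDegree_fibre_le (v : K × K) : (C v.2 * g - C v.1 * h).natDegree ≤ d := by
  simpa using natDegree_sub_le_of_le ((natDegree_C_mul_le v.2 _).trans H.left_le)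
    ((natDegree_C_mul_le v.1 _).trans H.right_le)

lemma IsLowest.eq_C_of_uniquePreimage_infty [IsAlgClosed K]
    (hu : UniquePreimage (ratMap d g h) OnePoint.infty) :
    ∃ κ : K, κ ≠ 0 ∧ C (h.coeff d) * g - C (g.coeff d) * h = C κ := by
  have hnr : ∀ a, ¬ (C (h.coeff d) * g - C (g.coeff d) * h).IsRoot a := fun a ha ↦ by
    refine OnePoint.coe_ne_infty a (hu a ((H.ratMap_eq_ratMap_iff _ _).2 ?_))
    rw [rep_coe, homEval_right_one (H.natDegree_fibre_le _)]
    simpa [lift, homEval_one_zero] using ha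
  have hdeg : (C (h.coeff d) * g - C (g.coeff d) * h).degree = 0 := by
    by_contra hne
    obtain ⟨a, ha⟩ := IsAlgClosed.exists_root _ hne
    exact hnr a ha
  obtain hκ := eq_C_of_degree_eq_zero hdeg
  refine ⟨_, fun h0 ↦ ?_, hκ⟩
  rw [h0] at hκ
  exact hnr 0 (by rw [hκ]; simp)

lemma IsLowest.eq_C_mul_pow_of_uniquePreimage_coe [IsAlgClosed K] {b : K}
    (hu : UniquePreimage (ratMap d g h) (b : OnePoint K)) :
    ∃ κ : K, κ ≠ 0 ∧ C (h.eval b) * g - C (g.eval b) * h = C κ * (X - C b) ^ d := by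
  set P := C (h.eval b) * g - C (g.eval b) * h with hP
  have hv : lift d g h (rep (b : OnePoint K)) = (g.eval b, h.eval b) := by
    simp [lift, homEval_right_one H.left_le, homEval_right_one H.right_le]
  have hPd : P.natDegree ≤ d := H.natDegree_fibre_le (g.eval b, h.eval b)
  have hiff : ∀ α : OnePoint K, homEval d P (rep α).1 (rep α).2 = 0 → α = (b : OnePoint K) :=
    fun α hα ↦ hu α ((H.ratMap_eq_ratMap_iff _ _).2 (by rw [hv]; exact hα))
  have hroot : ∀ a, P.IsRoot a → a = b := fun a ha ↦ by
    have := hiff a (by rw [rep_coe, homEval_right_one hPd]; exact ha)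
    exact OnePoint.coe_injective this
  have hlead : P.coeff d ≠ 0 := fun h0 ↦
    OnePoint.infty_ne_coe b (hiff OnePoint.infty (by
      rw [rep_infty, homEval_one_zero, h0, map_zero]))
  have hdeg : P.natDegree = d := le_antisymm hPd (le_natDegree_of_ne_zero hlead)
  have hroots : P.roots = Multiset.replicate d b := by
    refine Multiset.eq_replicate.2 ⟨?_, fun a ha ↦ hroot a (isRoot_of_mem_roots ha)⟩
    rw [← hdeg]
    exact splits_iff_card_roots.1 (IsAlgClosed.splits P)
  refine ⟨P.coeff d, hlead, ?_⟩
  have := C_leadingCoeff_mul_prod_multiset_X_sub_C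
    (p := P) (splits_iff_card_roots.1 (IsAlgClosed.splits P))
  rw [hroots, Multiset.map_replicate, Multiset.prod_replicate, leadingCoeff, hdeg] at this
  exact this.symm

/-- If `0` and `∞` are the only preimages of their images, then `g` and `h` are linear combinations
of `1` and `X ^ d`, and not proportional. -/
lemma IsLowest.coeff_eq_zero_of_uniquePreimage [IsAlgClosed K]
    (h0 : UniquePreimage (ratMap d g h) ((0 : K) : OnePoint K))
    (hi : UniquePreimage (ratMap d g h) OnePoint.infty) :
    h.coeff d * g.coeff 0 - g.coeff d * h.coeff 0 ≠ 0 ∧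
      ∀ i, i ≠ 0 → i ≠ d → g.coeff i = 0 ∧ h.coeff i = 0 := by
  obtain ⟨κ, hκ, h1⟩ := H.eq_C_of_uniquePreimage_infty hi
  obtain ⟨μ, hμ, h2⟩ := H.eq_C_mul_pow_of_uniquePreimage_coe h0
  have hD : h.coeff d * g.coeff 0 - g.coeff d * h.coeff 0 ≠ 0 := by
    have := congrArg (coeff · 0) h1
    simp only [coeff_sub, coeff_C_mul, coeff_C_zero] at this
    rwa [this]
  refine ⟨hD, fun i hi0 hid ↦ ?_⟩
  have e1 := congrArg (coeff · i) h1
  have e2 := congrArg (coeff · i) h2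
  simp only [coeff_sub, coeff_C_mul, coeff_C_of_ne_zero hi0] at e1
  simp only [coeff_sub, coeff_C_mul, C_0, sub_zero, coeff_X_pow, if_neg hid, mul_zero,
    ← coeff_zero_eq_eval_zero] at e2
  constructor
  · refine (mul_eq_zero.1 (?_ : (h.coeff d * g.coeff 0 - g.coeff d * h.coeff 0) * g.coeff i = 0)
      ).resolve_left hD
    linear_combination g.coeff 0 * e1 - g.coeff d * e2
  · refine (mul_eq_zero.1 (?_ : (h.coeff d * g.coeff 0 - g.coeff d * h.coeff 0) * h.coeff i = 0)
      ).resolve_left hD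
    linear_combination h.coeff 0 * e1 - h.coeff d * e2

omit H in
/-- If `(X - c) ^ d` and `X ^ d` differ by a constant and `c ≠ 0`, then `d` is a power of the
characteristic: otherwise remove the `p`-part of `d` and compare derivatives. -/
lemma exists_eq_pow_of_X_sub_C_pow (p : ℕ) [CharP K p] (hd : d ≠ 0) {c k : K} (hc : c ≠ 0)
    (h : (X - C c) ^ d = X ^ d + C k) : ∃ l, d = p ^ l := by
  have key : ∀ (m : ℕ) (c k : K), c ≠ 0 → (m : K) ≠ 0 → (X - C c) ^ m = X ^ m + C k → m = 1 := by
    intro m c k hc hm h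
    have h1 := congrArg (eval c ∘ derivative) h
    by_contra hm1
    have hm0 : m ≠ 0 := by rintro rfl; simp at hm
    have h2 : m - 1 ≠ 0 := by omega
    simp [derivative_pow, hm, hc, h2] at h1
  rcases CharP.char_is_prime_or_zero K p with hp | rfl
  · obtain ⟨l, m, hm, rfl⟩ := Nat.exists_eq_pow_mul_and_not_dvd hd p hp.ne_one
    refine ⟨l, ?_⟩
    have := Fact.mk hp
    have : ExpChar K p := .prime hp
    have h1 : expand K (p ^ l) ((X - C (c ^ p ^ l)) ^ m) = expand K (p ^ l) (X ^ m + C k) := by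
      simp only [map_pow, map_sub, map_add, expand_X, expand_C]
      rw [← sub_pow_expChar_pow, ← pow_mul, ← pow_mul, h]
    have h2 := expand_injective (pow_pos hp.pos l) h1
    have hm0 : (m : K) ≠ 0 := fun h0 ↦ hm ((CharP.cast_eq_zero_iff K p m).1 h0)
    rw [key m _ k (pow_ne_zero _ hc) hm0 h2, mul_one]
  · have := CharP.charP_to_charZero K
    exact ⟨0, by rw [pow_zero]; exact key d c k hc (Nat.cast_ne_zero.2 hd) h⟩

/-- A third such point forces the degree to be a power of the characteristic. -/
lemma IsLowest.exists_eq_pow_of_uniquePreimage [IsAlgClosed K] (p : ℕ) [CharP K p] (hd : d ≠ 0)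
    (h0 : UniquePreimage (ratMap d g h) ((0 : K) : OnePoint K))
    (hi : UniquePreimage (ratMap d g h) OnePoint.infty) {c : K} (hc : c ≠ 0)
    (hcu : UniquePreimage (ratMap d g h) (c : OnePoint K)) : ∃ l, d = p ^ l := by
  obtain ⟨-, hz⟩ := H.coeff_eq_zero_of_uniquePreimage h0 hi
  obtain ⟨μ, hμ, h2⟩ := H.eq_C_mul_pow_of_uniquePreimage_coe hcu
  refine exists_eq_pow_of_X_sub_C_pow p hd hc (k := ((X - C c) ^ d).coeff 0) ?_
  have hlead : ((X - C c) ^ d).coeff d = 1 := by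
    have := ((monic_X_sub_C c).pow d).coeff_natDegree
    rwa [natDegree_pow, natDegree_X_sub_C, mul_one] at this
  ext i
  rw [coeff_add, coeff_X_pow, coeff_C]
  by_cases hi0 : i = 0
  · subst hi0
    simp [hd.symm]
  by_cases hid : i = d
  · subst hid
    simp [hi0, hlead]
  · have := congrArg (coeff · i) h2
    simp only [coeff_sub, coeff_C_mul, (hz i hi0 hid).1, (hz i hi0 hid).2, mul_zero,
      sub_zero] at this
    rw [if_neg hid, if_neg hi0, add_zero]
    exact (mul_eq_zero.1 this.symm).resolve_left hμ

end Ramification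

/-! ### Rational functions of `X ^ d` of degree one -/

section LinearInPower

variable {F : Type*} [Field F]

lemma isCoprime_linear {a b a' b' : F} (hD : b' * a - b * a' ≠ 0) :
    IsCoprime (C a + C b * X) (C a' + C b' * X) := by
  refine ⟨C (b' / (b' * a - b * a')), -C (b / (b' * a - b * a')), ?_⟩
  have h1 : b' / (b' * a - b * a') * a - b / (b' * a - b * a') * a' = 1 := by
    field_simp
  have h2 : b' / (b' * a - b * a') * b - b / (b' * a - b * a') * b' = 0 := by
    field_simp
    ring
  calc _ = C (b' / (b' * a - b * a') * a - b / (b' * a - b * a') * a') +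
        C (b' / (b' * a - b * a') * b - b / (b' * a - b * a') * b') * X := by
        simp only [C_sub, C_mul]; ring
    _ = 1 := by rw [h1, h2]; simp

lemma degree_div_of_isCoprime {P Q : F[X]} (hQ : Q ≠ 0) (hPQ : IsCoprime P Q) :
    degree (algebraMap F[X] (RatFunc F) P / algebraMap F[X] (RatFunc F) Q) =
      max P.natDegree Q.natDegree := by
  set u := algebraMap F[X] (RatFunc F) P / algebraMap F[X] (RatFunc F) Q with hu
  have hmul : u.num * Q = P * u.denom := RatFunc.num_mul_eq_mul_denom_iff hQ |>.2 rfl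
  have hcop := RatFunc.isCoprime_num_denom u
  have h1 : Associated u.num P := associated_of_dvd_dvd
    (hcop.dvd_of_dvd_mul_right ⟨Q, hmul.symm⟩)
    (hPQ.dvd_of_dvd_mul_right ⟨u.denom, hmul⟩)
  have h2 : Associated u.denom Q := associated_of_dvd_dvd
    (hcop.symm.dvd_of_dvd_mul_left ⟨P, by rw [hmul, mul_comm]⟩)
    (hPQ.symm.dvd_of_dvd_mul_left ⟨u.num, by rw [← hmul, mul_comm]⟩)
  rw [degree, natDegree_eq_of_degree_eq (degree_eq_degree_of_associated h1),
    natDegree_eq_of_degree_eq (degree_eq_degree_of_associated h2)]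

/-- If numerator and denominator are linear combinations of `1` and `X ^ q`, then `f` is a
fractional linear function of `X ^ q`. -/
lemma exists_eq_comp_X_pow {f : RatFunc F} {q : ℕ} {a b a' b' : F}
    (hD : b' * a - b * a' ≠ 0) (hnum : f.num = C a + C b * X ^ q)
    (hdenom : f.denom = C a' + C b' * X ^ q) :
    ∃ L : RatFunc F, degree L = 1 ∧ f = comp L (RatFunc.X ^ q) := by
  have hcop := isCoprime_linear hD
  have hQ : C a' + C b' * X ≠ 0 := by
    intro h0
    have h1 := congrArg (coeff · 0) h0
    have h2 := congrArg (coeff · 1) h0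
    simp at h1 h2
    simp [h1, h2] at hD
  set L : RatFunc F := algebraMap F[X] (RatFunc F) (C a + C b * X) /
    algebraMap F[X] (RatFunc F) (C a' + C b' * X) with hL
  have hL1 : degree L = 1 := by
    rw [degree_div_of_isCoprime hQ hcop]
    have hle : ∀ s t : F, (C s + C t * X).natDegree ≤ 1 := fun s t ↦ by
      rw [add_comm]; exact natDegree_linear_le
    refine le_antisymm (max_le (hle _ _) (hle _ _)) ?_
    by_contra! hlt
    have hz : ∀ s t : F, (C s + C t * X).natDegree < 1 → t = 0 := fun s t h ↦ by
      simpa using coeff_eq_zero_of_natDegree_lt h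
    rw [max_lt_iff] at hlt
    have h1 := hz _ _ hlt.1
    have h2 := hz _ _ hlt.2
    simp [h1, h2] at hD
  refine ⟨L, hL1, ?_⟩
  have hmul : L.num * (C a' + C b' * X) = (C a + C b * X) * L.denom :=
    RatFunc.num_mul_eq_mul_denom_iff hQ |>.2 rfl
  have hev := congrArg (eval₂ RatFunc.C (RatFunc.X ^ q : RatFunc F)) hmul
  have heq : ∀ s t : F, eval₂ RatFunc.C (RatFunc.X ^ q : RatFunc F) (C s + C t * X) =
      algebraMap F[X] (RatFunc F) (C s + C t * X ^ q) := fun s t ↦ by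
    simp [RatFunc.algebraMap_C, RatFunc.algebraMap_X]
  rw [eval₂_mul, eval₂_mul, heq, heq, ← hnum, ← hdenom] at hev
  have hd0 : algebraMap F[X] (RatFunc F) f.denom ≠ 0 :=
    RatFunc.algebraMap_ne_zero f.denom_ne_zero
  have hLd : eval₂ RatFunc.C (RatFunc.X ^ q : RatFunc F) L.denom ≠ 0 := by
    intro h0
    obtain ⟨R, hR⟩ := RatFunc.denom_div_dvd (C a + C b * X) (C a' + C b' * X)
    have := congrArg (eval₂ RatFunc.C (RatFunc.X ^ q : RatFunc F)) hR
    rw [heq, eval₂_mul, ← hL, h0, zero_mul, ← hdenom] at this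
    exact hd0 this
  rw [comp, RatFunc.eval, eq_div_iff hLd]
  conv_lhs => rw [← RatFunc.num_div_denom f]
  rw [div_mul_eq_mul_div, div_eq_iff hd0]
  exact hev.symm

open IntermediateField in
/-- A fractional linear function of `X ^ (p ^ l)` is inseparable unless `l = 0`: `X` is purely
inseparable over `F(f)`. -/
lemma not_separable_of_X_pow (p : ℕ) [CharP F p] {f : RatFunc F} {l : ℕ} (hdeg : 2 ≤ degree f)
    (hl : 2 ≤ p ^ l) {a b a' b' : F}
    (hD : b' * a - b * a' ≠ 0) (hnum : f.num = C a + C b * X ^ (p ^ l))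
    (hdenom : f.denom = C a' + C b' * X ^ (p ^ l)) : ¬ Separable f := by
  intro hsep
  have hp : p.Prime := (CharP.char_is_prime_or_zero F p).resolve_right <| by
    rintro rfl
    rcases l.eq_zero_or_pos with rfl | h0
    · simp at hl
    · rw [zero_pow h0.ne'] at hl
      omega
  have := Fact.mk hp
  have : CharP F⟮f⟯ p := charP_of_injective_algebraMap (algebraMap F F⟮f⟯).injective p
  have : ExpChar F⟮f⟯ p := .prime hp
  have : Algebra.IsSeparable F⟮f⟯ (RatFunc F) := hsep
  have hf : f * (RatFunc.C a' + RatFunc.C b' * RatFunc.X ^ (p ^ l)) =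
      RatFunc.C a + RatFunc.C b * RatFunc.X ^ (p ^ l) := by
    have h1 : ∀ s t : F, RatFunc.C s + RatFunc.C t * RatFunc.X ^ (p ^ l) =
      algebraMap F[X] (RatFunc F) (C s + C t * X ^ (p ^ l)) := fun s t ↦ by
      simp [RatFunc.algebraMap_C, RatFunc.algebraMap_X]
    rw [h1, h1, ← hnum, ← hdenom]
    nth_rewrite 1 [← RatFunc.num_div_denom f]
    exact div_mul_cancel₀ _ (RatFunc.algebraMap_ne_zero f.denom_ne_zero)
  have hne : RatFunc.C b' * f - RatFunc.C b ≠ 0 := by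
    intro h0
    have h2 : RatFunc.C (b' * a - b * a') = 0 := by
      rw [map_sub, map_mul, map_mul]
      linear_combination (-RatFunc.C b') * hf +
        (RatFunc.C a' + RatFunc.C b' * RatFunc.X ^ (p ^ l)) * h0
    rw [map_eq_zero] at h2
    exact hD h2
  have hX : (RatFunc.X : RatFunc F) ^ (p ^ l) =
      (RatFunc.C a - RatFunc.C a' * f) / (RatFunc.C b' * f - RatFunc.C b) := by
    rw [eq_div_iff hne]
    linear_combination hf
  have hfmem : f ∈ F⟮f⟯ := mem_adjoin_simple_self F f
  have hCmem : ∀ s : F, RatFunc.C s ∈ F⟮f⟯ := fun s ↦ F⟮f⟯.algebraMap_mem s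
  have hmem : (RatFunc.X : RatFunc F) ^ (p ^ l) ∈ F⟮f⟯ := by
    rw [hX]
    exact div_mem (sub_mem (hCmem _) (mul_mem (hCmem _) hfmem))
      (sub_mem (mul_mem (hCmem _) hfmem) (hCmem _))
  have hXp : (RatFunc.X : RatFunc F) ∈ perfectClosure F⟮f⟯ (RatFunc F) :=
    (mem_perfectClosure_iff_pow_mem p).2 ⟨l, ⟨_, hmem⟩, rfl⟩
  rw [perfectClosure.eq_bot_of_isSeparable, mem_bot] at hXp
  obtain ⟨y, hy⟩ := hXp
  have hXmem : (RatFunc.X : RatFunc F) ∈ F⟮f⟯ := hy ▸ y.2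
  have htop : F⟮f⟯ = ⊤ := by
    rw [eq_top_iff, ← RatFunc.adjoin_X, adjoin_simple_le_iff]
    exact hXmem
  have hfin := RatFunc.finrank_eq_max_natDegree f
  rw [htop, IntermediateField.finrank_top] at hfin
  rw [degree, ← hfin] at hdeg
  omega

end LinearInPower

/-! ### The three cases -/

section Cases

variable {F : Type*} [Field F] {f : RatFunc F} {d : ℕ} (hd : degree f = d) (hd2 : 2 ≤ d)
include hd hd2

local notation "Kbar" => AlgebraicClosure F
local notation "φ" => pointMap f d (AlgebraicClosure F)
local notation "pt0" => ((0 : AlgebraicClosure F) : OnePoint (AlgebraicClosure F))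

lemma surjective_pointMap : Function.Surjective φ :=
  (isLowest_map hd Kbar).surjective (by omega)

lemma pow_le_Psi_of_le {n m s : ℕ} (hn : 1 ≤ n)
    (h : HasFreshFibre φ pt0 OnePoint.infty n m) (hs : s ≤ m) : d ^ s ≤ Psi f n :=
  (Nat.pow_le_pow_right (by omega) hs).trans (pow_le_Psi hd Kbar (by omega) hn h)

lemma zeroPeriod_le {k : ℕ} (hk : 1 ≤ k) (h : φ^[k] pt0 = pt0) :
    zeroPeriod f ≤ k :=
  iInf₂_le (f := fun (k : ℕ) (_ : k ∈ {k : ℕ | 1 ≤ k ∧ (iter f k).num.eval 0 = 0}) ↦ (k : ℕ∞)) k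
    ⟨hk, (num_iter_eval_zero_iff hd Kbar (by omega) k).2 h⟩

/-- Numerator and denominator when `0` and `∞` each are the only preimage of their image. -/
lemma num_denom_of_uniquePreimage (h0 : UniquePreimage φ pt0)
    (hi : UniquePreimage φ OnePoint.infty) :
    f.denom.coeff d * f.num.coeff 0 - f.num.coeff d * f.denom.coeff 0 ≠ 0 ∧
      f.num = C (f.num.coeff 0) + C (f.num.coeff d) * X ^ d ∧
      f.denom = C (f.denom.coeff 0) + C (f.denom.coeff d) * X ^ d := by
  obtain ⟨hD, hz⟩ := (isLowest_map hd Kbar).coeff_eq_zero_of_uniquePreimage h0 hi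
  simp only [coeff_map, ← map_mul, ← map_sub, Ne, map_eq_zero] at hD hz
  have hform : ∀ P : F[X], (∀ i, i ≠ 0 → i ≠ d → P.coeff i = 0) →
      P = C (P.coeff 0) + C (P.coeff d) * X ^ d := by
    intro P hP
    ext i
    rw [coeff_add, coeff_C, coeff_C_mul, coeff_X_pow]
    by_cases hi0 : i = 0
    · subst hi0
      simp [show ¬ (0 = d) by omega]
    · by_cases hid : i = d
      · subst hid
        simp [hi0]
      · simp [hi0, hid, hP i hi0 hid]
  exact ⟨hD, hform _ fun i h1 h2 ↦ (hz i h1 h2).1, hform _ fun i h1 h2 ↦ (hz i h1 h2).2⟩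

lemma exists_eq_pow_of_third_point (p : ℕ) [CharP F p] (h0 : UniquePreimage φ pt0)
    (hi : UniquePreimage φ OnePoint.infty) {c : OnePoint Kbar} (hc0 : c ≠ pt0)
    (hci : c ≠ OnePoint.infty) (hc : UniquePreimage φ c) : ∃ l, d = p ^ l := by
  obtain ⟨c, rfl⟩ := OnePoint.ne_infty_iff_exists.1 hci
  have : CharP Kbar p := charP_of_injective_algebraMap (algebraMap F Kbar).injective p
  exact (isLowest_map hd Kbar).exists_eq_pow_of_uniquePreimage p (by omega) h0 hi
    (fun h ↦ hc0 (by rw [h])) hc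

/-- A polynomial has `∞` as a fixed point without other preimages. If `0` is periodic of period `e`
and has no other preimage under `f⁽ᵉ⁾`, then either `e = 1` and `f` is a monomial, or `f(0)` is a
third point with a unique preimage of its image. -/
theorem pow_le_Psi_of_polynomial (p : ℕ) [CharP F p]
    (hmonomial : ¬ ∃ (a : F) (m : ℤ), f = RatFunc.C a * RatFunc.X ^ m)
    (hbinomial : ¬ ∃ (a b : F) (l : ℕ), f = RatFunc.C a * RatFunc.X ^ (p ^ l) + RatFunc.C b)
    (hf : f ∈ Set.range (algebraMap F[X] (RatFunc F))) {n : ℕ} (hn : 1 ≤ n) :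
    ((n : ℕ∞) ≤ zeroPeriod f → d ^ n ≤ Psi f n) ∧
      ∀ e : ℕ, zeroPeriod f = e → e < n → d ^ (n - e) ≤ Psi f n := by
  have H := isLowest_map hd Kbar
  have hdenom : f.denom = 1 := by
    obtain ⟨P, rfl⟩ := hf
    exact RatFunc.denom_algebraMap P
  have hne : pt0 ≠ OnePoint.infty := OnePoint.coe_ne_infty _
  have hfix : φ OnePoint.infty = OnePoint.infty := by
    rw [ratMap_infty_eq_infty_iff, hdenom]
    simp [coeff_one, show d ≠ 0 by omega]
  have hi : UniquePreimage φ OnePoint.infty := by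
    intro y hy
    rw [hfix] at hy
    induction y using OnePoint.rec with
    | infty => rfl
    | coe c =>
      rw [H.ratMap_coe_eq_infty_iff, hdenom] at hy
      simp at hy
  by_cases hper : ∃ k, 1 ≤ k ∧ φ^[k] pt0 = pt0
  · obtain ⟨e, he1, he, hmin⟩ := exists_least_iterate_eq hper
    have hE := entersThrough_of_fixed hne hfix he hmin
    have hze : zeroPeriod f = e := by
      refine le_antisymm (zeroPeriod_le hd hd2 he1 he) (le_iInf₂ fun k hk ↦ ?_)
      exact_mod_cast hmin k hk.1 ((num_iter_eval_zero_iff hd Kbar (by omega) k).1 hk.2)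
    refine ⟨fun hne' ↦ ?_, fun e' he' hn' ↦ ?_⟩
    · rw [hze] at hne'
      exact pow_le_Psi_of_le hd hd2 hn
        (hE.hasFreshFibre_self (.inl rfl) (by exact_mod_cast hne')) le_rfl
    · obtain rfl : e = e' := by exact_mod_cast hze.symm.trans he'
      by_cases hβ : ∀ β, φ^[e] β = pt0 → β = pt0
      · exfalso
        have htr := fun i (hi : i < e) ↦
          uniquePreimage_of_iterate (surjective_pointMap hd hd2) hβ hi
        have h0 : UniquePreimage φ pt0 := htr 0 he1
        obtain ⟨-, hnum, -⟩ := num_denom_of_uniquePreimage hd hd2 h0 hi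
        have hfeq : f = RatFunc.C (f.num.coeff d) * RatFunc.X ^ d +
            RatFunc.C (f.num.coeff 0) := by
          conv_lhs => rw [← RatFunc.num_div_denom f, hdenom, hnum]
          simp [RatFunc.algebraMap_C, RatFunc.algebraMap_X, add_comm]
        by_cases hφ0 : φ pt0 = pt0
        · rw [H.ratMap_coe_eq_zero_iff, ← coeff_zero_eq_eval_zero, coeff_map, map_eq_zero] at hφ0
          rw [hφ0, map_zero, add_zero] at hfeq
          exact hmonomial ⟨_, d, by rw [zpow_natCast]; exact hfeq⟩
        · have he2 : 1 < e := lt_of_le_of_ne he1 (by rintro rfl; exact hφ0 he)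
          obtain ⟨l, hl⟩ := exists_eq_pow_of_third_point hd hd2 p h0 hi hφ0
            (fun h ↦ hne (hi pt0 (h.trans hfix.symm))) (htr 1 he2)
          exact hbinomial ⟨_, _, l, by rw [← hl]; exact hfeq⟩
      · push Not at hβ
        obtain ⟨β, h1, h2⟩ := hβ
        exact pow_le_Psi_of_le hd hd2 hn (hE.hasFreshFibre_sub (.inl rfl) h1 h2 hn'.le) le_rfl
  · have hfresh : HasFreshFibre φ pt0 OnePoint.infty n n := by
      refine hasFreshFibre_self_of_not_reached (.inl rfl) ?_ n
      rintro u (rfl | rfl) k hk hku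
      · exact hper ⟨k, hk, hku⟩
      · rw [Function.iterate_fixed hfix] at hku
        exact hne hku.symm
    exact ⟨fun _ ↦ pow_le_Psi_of_le hd hd2 hn hfresh le_rfl,
      fun e _ _ ↦ pow_le_Psi_of_le hd hd2 hn hfresh (Nat.sub_le _ _)⟩

/-- Here `f(∞) = ∞` or `f(∞) = 0`, and `∞` is not the only preimage of `f(∞)`. -/
theorem pow_le_Psi_of_natDegree_ne
    (h : f.denom.natDegree < f.num.natDegree ∧ 1 ≤ f.denom.natDegree ∨
      1 ≤ f.num.natDegree ∧ f.num.natDegree < f.denom.natDegree) {n : ℕ} (hn : 1 ≤ n) :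
    d ^ (n - 1) ≤ Psi f n := by
  have H := isLowest_map hd Kbar
  have hne : pt0 ≠ OnePoint.infty := OnePoint.coe_ne_infty _
  have hroot : ∀ P : F[X], 1 ≤ P.natDegree → ∃ c, (P.map (algebraMap F Kbar)).eval c = 0 := by
    intro P hP
    refine IsAlgClosed.exists_root _ fun h0 ↦ ?_
    rw [degree_map] at h0
    have := natDegree_eq_zero_iff_degree_le_zero.2 h0.le
    omega
  have hfresh : HasFreshFibre φ pt0 OnePoint.infty n n ∨
      HasFreshFibre φ pt0 OnePoint.infty n (n - 1) := by
    rcases h with ⟨h1, h2⟩ | ⟨h1, h2⟩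
    · obtain ⟨c, hc⟩ := hroot _ h2
      have hnd : f.denom.natDegree < d := h1.trans_le (natDegree_num_le hd)
      refine hasFreshFibre_of_fixed_of_preimage hne ?_
        ((H.ratMap_coe_eq_infty_iff c).2 hc) (OnePoint.coe_ne_infty c) hn
      rw [ratMap_infty_eq_infty_iff, coeff_map, coeff_eq_zero_of_natDegree_lt hnd, map_zero]
    · obtain ⟨c, hc⟩ := hroot _ h1
      have hnd : f.num.natDegree < d := h2.trans_le (natDegree_denom_le hd)
      refine hasFreshFibre_of_map_eq_of_preimage hne ?_
        ((H.ratMap_coe_eq_zero_iff c).2 hc) (OnePoint.coe_ne_infty c) hn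
      rw [H.ratMap_infty_eq_zero_iff, coeff_map, coeff_eq_zero_of_natDegree_lt hnd, map_zero]
  rcases hfresh with h | h
  · exact pow_le_Psi_of_le hd hd2 hn h (Nat.sub_le _ _)
  · exact pow_le_Psi_of_le hd hd2 hn h le_rfl

/-- Here `f(∞) ≠ ∞`, so that two points without other preimages of their images force a third one
unless `f` is a monomial. -/
theorem exists_pow_le_Psi_of_natDegree_le (p : ℕ) [CharP F p]
    (hmonomial : ¬ ∃ (a : F) (m : ℤ), f = RatFunc.C a * RatFunc.X ^ m)
    (h : f.num.natDegree ≤ f.denom.natDegree)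
    (hsep : Separable f ∨ ¬ ∃ (L : RatFunc F) (l : ℕ), degree L = 1 ∧
      f = comp L (RatFunc.X ^ (p ^ l))) :
    ∃ j : ℕ, ∀ n : ℕ, 1 ≤ n →
      (n ≤ j → d ^ n ≤ Psi f n) ∧ (j < n → d ^ (n - j) ≤ Psi f n) := by
  have H := isLowest_map hd Kbar
  have hne : pt0 ≠ OnePoint.infty := OnePoint.coe_ne_infty _
  have hinf : φ OnePoint.infty ≠ OnePoint.infty := by
    have hdd : f.denom.natDegree = d := by rw [← hd, degree, max_eq_right h]
    rw [Ne, ratMap_infty_eq_infty_iff, coeff_map, map_eq_zero, ← hdd, coeff_natDegree,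
      leadingCoeff_eq_zero]
    exact f.denom_ne_zero
  rcases exists_hasFreshFibre_or_uniquePreimage (surjective_pointMap hd hd2) hne hinf with
    ⟨j, hj⟩ | ⟨h0, hi, hc⟩
  · exact ⟨j, fun n hn ↦ ⟨fun hnj ↦ pow_le_Psi_of_le hd hd2 hn ((hj n).1 hnj) le_rfl,
      fun hnj ↦ pow_le_Psi_of_le hd hd2 hn ((hj n).2 hnj) le_rfl⟩⟩
  · exfalso
    obtain ⟨hD, hnum, hdenom⟩ := num_denom_of_uniquePreimage hd hd2 h0 hi
    rcases hc with ⟨c, hc0, hci, hc⟩ | ⟨hzi, hiz⟩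
    · obtain ⟨l, hl⟩ := exists_eq_pow_of_third_point hd hd2 p h0 hi hc0 hci hc
      rcases hsep with hsep | hL
      · exact not_separable_of_X_pow p (hd ▸ hd2) (hl ▸ hd2) hD (hl ▸ hnum) (hl ▸ hdenom) hsep
      · obtain ⟨L, hL1, hL2⟩ := exists_eq_comp_X_pow hD hnum hdenom
        exact hL ⟨L, l, hL1, by rw [← hl]; exact hL2⟩
    · rw [H.ratMap_coe_eq_infty_iff, ← coeff_zero_eq_eval_zero, coeff_map, map_eq_zero] at hzi
      rw [H.ratMap_infty_eq_zero_iff, coeff_map, map_eq_zero] at hiz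
      rw [hiz, C_0, zero_mul, add_zero] at hnum
      rw [hzi, C_0, zero_add] at hdenom
      refine hmonomial ⟨f.num.coeff 0 / f.denom.coeff d, -d, ?_⟩
      conv_lhs => rw [← RatFunc.num_div_denom f, hnum, hdenom]
      rw [map_mul, map_pow, RatFunc.algebraMap_C, RatFunc.algebraMap_C, RatFunc.algebraMap_X,
        map_div₀, zpow_neg, zpow_natCast, div_mul_eq_div_div, div_eq_mul_inv (_ / _)]

end Cases

end RationalIteration

theorem theorem1 {F : Type*} [Field F] (p : ℕ) [CharP F p] (f : RatFunc F) (d : ℕ)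
    (hd : RationalIteration.degree f = d) (hd2 : 2 ≤ d)
    (hmonomial : ¬ ∃ (a : F) (m : ℤ), f = RatFunc.C a * RatFunc.X ^ m)
    (hbinomial : ¬ ∃ (a b : F) (l : ℕ), f = RatFunc.C a * RatFunc.X ^ (p ^ l) + RatFunc.C b)
    (hconj : ¬ RationalIteration.LinearlyConjugate f (1 / RatFunc.X ^ d)) :
    (f ∈ Set.range (algebraMap (Polynomial F) (RatFunc F)) →
      ∀ n : ℕ, 1 ≤ n →
        ((n : ℕ∞) ≤ RationalIteration.zeroPeriod f → d ^ n ≤ RationalIteration.Psi f n) ∧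
        (∀ e : ℕ, RationalIteration.zeroPeriod f = e → e < n →
          d ^ (n - e) ≤ RationalIteration.Psi f n)) ∧
    ((f.denom.natDegree < f.num.natDegree ∧ 1 ≤ f.denom.natDegree ∨
        1 ≤ f.num.natDegree ∧ f.num.natDegree < f.denom.natDegree) →
      ∀ n : ℕ, 1 ≤ n → d ^ (n - 1) ≤ RationalIteration.Psi f n) ∧
    ((f.num.natDegree = 0 ∧ 0 < f.denom.natDegree ∨ f.num.natDegree = f.denom.natDegree) →
      (RationalIteration.Separable f ∨
        ¬ ∃ (L : RatFunc F) (l : ℕ), RationalIteration.degree L = 1 ∧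
          f = RationalIteration.comp L (RatFunc.X ^ (p ^ l))) →
      ∃ j : ℕ, ∀ n : ℕ, 1 ≤ n →
        (n ≤ j → d ^ n ≤ RationalIteration.Psi f n) ∧
        (j < n → d ^ (n - j) ≤ RationalIteration.Psi f n)) := by
  refine ⟨fun hf n hn ↦
      RationalIteration.pow_le_Psi_of_polynomial hd hd2 p hmonomial hbinomial hf hn,
    fun h n hn ↦ RationalIteration.pow_le_Psi_of_natDegree_ne hd hd2 h hn,
    fun h hsep ↦ RationalIteration.exists_pow_le_Psi_of_natDegree_le hd hd2 p hmonomial ?_ hsep⟩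
  rcases h with ⟨h1, h2⟩ | h
  · omega
  · exact h.le
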